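/- Let $R$ be a field and let $D$ be a cocommutative Hopf algebra over $R$ which is pointed (every simple subcoalgebra is one-dimensional) and whose irreducible component $D^1$ containing $1$ is of Birkhoff–Witt type: every primitive element of $D$ is the term $d_1$ of an infinite sequence $1=d_0,d_1,d_2,\dots$ in $D^1$ with $\Delta(d_n)=\sum_{i=0}^n d_i\otimes d_{n-i}$ for all $n$. A $D$-module algebra is a commutative $R$-algebra $A$ with a $D$-module structure (compatible with its $R$-module structure) such that $d(ab)=\sum_{(d)}(d_{(1)}a)(d_{(2)}b)$ and $d(1)=\varepsilon(d)1$ for all $d\in D$, $a,b\in A$. It is called AS (artinian simple) if it is nonzero, artinian as a ring, and has no $D$-stable ideals other than $0$ and $A$. Let $K\subset L$ be an inclusion of AS $D$-module algebras. The $(L,L)$-bimodule $L\otimes_K L$ is an $L$-coring with $\Delta(a\otimes b)=(a\otimes 1)\otimes_L(1\otimes b)$ and $\varepsilon(a\otimes b)=ab$, and $D$ acts on it by $d(a\otimes b)=\sum_{(d)}d_{(1)}a\otimes d_{(2)}b$. A coideal of $C=L\otimes_K L$ is an $(L,L)$-sub-bimodule $J$ with $\varepsilon(J)=0$ such that $\Delta(J)$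 is contained in the sum of the images of $J\otimes_L C$ and $C\otimes_L J$ in $C\otimes_L C$. Let $\mathcal C_{L/K}$ be the set of all $D$-stable coideals of $L\otimes_K L$, and let $\mathcal A_{L/K}$ be the set of all intermediate AS $D$-module algebras of $L/K$, i.e. the $D$-stable subalgebras $K\subset M\subset L$ which are AS. (i) For every $M\in\mathcal A_{L/K}$, the kernel $J_M:=\operatorname{Ker}(L\otimes_K L\twoheadrightarrow L\otimes_M L)$ belongs to $\mathcal C_{L/K}$. (ii) For every $J\in\mathcal C_{L/K}$, with canonical surjection $\pi:L\otimes_K L\twoheadrightarrow (L\otimes_K L)/J$, the set $M_J:=\{a\in L\mid a\,\pi(1\otimes 1)=\pi(1\otimes 1)\,a\}$ belongs to $\mathcal A_{L/K}$. (iii) The maps $J\mapsto M_J$ and $M\mapsto J_M$ are mutually inverse bijections between $\mathcal C_{L/K}$ and $\mathcal A_{L/K}$. -/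

import Mathlib

open scoped TensorProduct

namespace DModAlg

/-! ### Pointed coalgebras, the irreducible component of `1`, Birkhoff-Witt type -/

section Coalgebras

variable (R D : Type*) [Field R] [Ring D] [HopfAlgebra R D]

/-- `C` is a subcoalgebra: `Δ(C)` lies in the image of `C ⊗ C` in `D ⊗ D`. -/
def IsSubcoalgebra (C : Submodule R D) : Prop :=
  ∀ c ∈ C, Coalgebra.comul (R := R) c ∈ LinearMap.range (TensorProduct.map C.subtype C.subtype)

/-- A simple subcoalgebra: nonzero, without proper nonzero subcoalgebras. -/
def IsSimpleSubcoalgebra (C : Submodule R D) : Prop :=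
  IsSubcoalgebra R D C ∧ C ≠ ⊥ ∧ ∀ C' : Submodule R D, IsSubcoalgebra R D C' → C' ≤ C →
    C' = ⊥ ∨ C' = C

/-- `D` is pointed: every simple subcoalgebra is one-dimensional. -/
def IsPointed : Prop :=
  ∀ C : Submodule R D, IsSimpleSubcoalgebra R D C → Module.finrank R C = 1

/-- An irreducible subcoalgebra: any two nonzero subcoalgebras of it intersect nontrivially. -/
def IsIrreducibleSubcoalgebra (C : Submodule R D) : Prop :=
  IsSubcoalgebra R D C ∧ ∀ C₁ C₂ : Submodule R D,
    IsSubcoalgebra R D C₁ → IsSubcoalgebra R D C₂ → C₁ ≤ C → C₂ ≤ C →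
      C₁ ≠ ⊥ → C₂ ≠ ⊥ → C₁ ⊓ C₂ ≠ ⊥

/-- The irreducible component `D¹` of `D` containing `1`: the sum of all irreducible
subcoalgebras that contain `1`. -/
def irreducibleComponentOne : Submodule R D :=
  sSup {C | IsIrreducibleSubcoalgebra R D C ∧ (1 : D) ∈ C}

/-- `x` is primitive. -/
def IsPrimitive (x : D) : Prop :=
  Coalgebra.comul (R := R) x = x ⊗ₜ[R] 1 + 1 ⊗ₜ[R] x

/-- `1 = d₀, d₁, d₂, …` is a divided power sequence of infinite length in `D¹`. -/
def IsDividedPowerSeq (d : ℕ → D) : Prop :=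
  d 0 = 1 ∧ (∀ n, d n ∈ irreducibleComponentOne R D) ∧
    ∀ n, Coalgebra.comul (R := R) (d n) =
      ∑ i ∈ Finset.range (n + 1), d i ⊗ₜ[R] d (n - i)

/-- `D¹` is of Birkhoff-Witt type: each primitive element is the term `d₁` of a divided power
sequence of infinite length. -/
def IsBirkhoffWitt : Prop :=
  ∀ x : D, IsPrimitive R D x → ∃ d : ℕ → D, IsDividedPowerSeq R D d ∧ d 1 = x

end Coalgebras

/-! ### `D`-module algebras -/

section ModuleAlgebras

variable (R D A : Type*) [Field R] [Ring D] [HopfAlgebra R D]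
  [CommRing A] [Algebra R A] [Module D A] [IsScalarTower R D A]

variable {D A} in
/-- The `R`-linear map `D → A`, `d ↦ d a`. -/
def act (a : A) : D →ₗ[R] A := (LinearMap.toSpanSingleton D A a).restrictScalars R

/-- `A` is a `D`-module algebra: `d (a b) = ∑ (d₁ a) (d₂ b)` and `d 1 = ε(d) 1`. -/
class IsModuleAlgebra : Prop where
  smul_mul : ∀ (d : D) (a b : A), d • (a * b) =
    LinearMap.mul' R A (TensorProduct.map (act R a) (act R b) (Coalgebra.comul (R := R) d))
  smul_one : ∀ d : D, d • (1 : A) = algebraMap R A (Coalgebra.counit (R := R) d)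

end ModuleAlgebras

/-- `A` is artinian simple (AS): it is artinian as a ring, nonzero, and its only `D`-stable
ideals are `0` and `A`. -/
structure IsAS (D A : Type*) [Ring D] [CommRing A] [Module D A] : Prop where
  artinian : IsArtinianRing A
  nontrivial : Nontrivial A
  simple : ∀ I : Ideal A, (∀ (d : D), ∀ x ∈ I, d • x ∈ I) → I = ⊥ ∨ I = ⊤

/-- The `R`-algebra map `K → L` is an inclusion of `D`-module algebras. -/
class IsInclusion (D K L : Type*) [Ring D] [CommRing K] [CommRing L] [Algebra K L]
    [Module D K] [Module D L] : Prop where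
  injective : Function.Injective (algebraMap K L)
  map_smul : ∀ (d : D) (k : K), algebraMap K L (d • k) = d • algebraMap K L k

/-! ### Intermediate `D`-module algebras -/

section Intermediate

variable (D : Type*) {K L : Type*} [Ring D] [CommRing K] [CommRing L] [Algebra K L] [Module D L]

/-- `M` is stable under the action of `D` on `L`. -/
def IsStableSubalgebra (M : Subalgebra K L) : Prop := ∀ (d : D), ∀ x ∈ M, d • x ∈ M

variable {D} in
/-- The restricted action of `D` on a stable subalgebra. -/
abbrev subalgebraModule {M : Subalgebra K L} (h : IsStableSubalgebra D M) : Module D M where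
  smul d x := ⟨d • (x : L), h d x x.2⟩
  one_smul x := Subtype.ext (one_smul D (x : L))
  mul_smul c d x := Subtype.ext (mul_smul c d (x : L))
  smul_zero d := Subtype.ext (smul_zero d)
  smul_add d x y := Subtype.ext (smul_add d (x : L) (y : L))
  add_smul c d x := Subtype.ext (add_smul c d (x : L))
  zero_smul x := Subtype.ext (zero_smul D (x : L))

variable (K L) in
/-- The set `𝒜_{L/K}` of intermediate AS `D`-module algebras `K ⊂ M ⊂ L`. -/
def intermediateAS : Set (Subalgebra K L) :=
  {M | ∃ h : IsStableSubalgebra D M, @IsAS D M _ _ (subalgebraModule h)}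

end Intermediate

/-! ### The `L`-coring `L ⊗_K L` -/

section Coring

variable (K L : Type*) [CommRing K] [CommRing L] [Algebra K L]

variable {K L} in
/-- The left action of `a ∈ L` on `L ⊗_K L`: `a (x ⊗ y) = a x ⊗ y`. -/
noncomputable def leftAct (a : L) : L ⊗[K] L →ₗ[K] L ⊗[K] L :=
  TensorProduct.map (LinearMap.mulLeft K a) LinearMap.id

variable {K L} in
/-- The right action of `a ∈ L` on `L ⊗_K L`: `(x ⊗ y) a = x ⊗ y a`. -/
noncomputable def rightAct (a : L) : L ⊗[K] L →ₗ[K] L ⊗[K] L :=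
  TensorProduct.map LinearMap.id (LinearMap.mulRight K a)

/-- An `(L, L)`-sub-bimodule of `L ⊗_K L`. -/
@[ext]
structure SubBimodule extends AddSubgroup (L ⊗[K] L) where
  left_mem' : ∀ (a : L), ∀ x ∈ carrier, leftAct a x ∈ carrier
  right_mem' : ∀ (a : L), ∀ x ∈ carrier, rightAct a x ∈ carrier

/-- The counit `ε : L ⊗_K L → L`, `a ⊗ b ↦ a b`. -/
noncomputable def coringCounit : L ⊗[K] L →ₗ[K] L := LinearMap.mul' K L

/-- `L ⊗_K L`, regarded as an `L`-module through the right factor. -/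
def RightTensor : Type _ := L ⊗[K] L

noncomputable instance : AddCommGroup (RightTensor K L) :=
  inferInstanceAs (AddCommGroup (L ⊗[K] L))

noncomputable instance : Module L (RightTensor K L) :=
  Module.compHom (L ⊗[K] L)
    (Algebra.TensorProduct.includeRight : L →ₐ[K] L ⊗[K] L).toRingHom

variable {K L} in
/-- The identity map from `L ⊗_K L` to itself with the right `L`-module structure. -/
def toRight (x : L ⊗[K] L) : RightTensor K L := x

theorem smul_toRight (a : L) (x : L ⊗[K] L) : a • toRight x = toRight (rightAct a x) := by
  change (1 ⊗ₜ[K] a) * x = rightAct a x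
  induction x with
  | zero => simp
  | add x y hx hy => simp [mul_add, hx, hy]
  | tmul x y => simp [rightAct, mul_comm]

/-- The tensor product `(L ⊗_K L) ⊗_L (L ⊗_K L)` of `(L, L)`-bimodules: the right action on the
first factor is balanced against the left action on the second one. -/
abbrev CoringTensor : Type _ := RightTensor K L ⊗[L] (L ⊗[K] L)

/-- The comultiplication `Δ(a ⊗ b) = (a ⊗ 1) ⊗ (1 ⊗ b)`. -/
noncomputable def coringComul : L ⊗[K] L →+ CoringTensor K L :=
  TensorProduct.liftAddHom
    (AddMonoidHom.mk' (fun a : L =>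
      AddMonoidHom.mk' (fun b : L => toRight (a ⊗ₜ[K] (1 : L)) ⊗ₜ[L] ((1 : L) ⊗ₜ[K] b))
        (fun b c => by rw [TensorProduct.tmul_add, TensorProduct.tmul_add]))
      (fun a c => by
        ext b
        change toRight ((a + c) ⊗ₜ[K] (1 : L)) ⊗ₜ[L] ((1 : L) ⊗ₜ[K] b) = _
        rw [TensorProduct.add_tmul]
        exact TensorProduct.add_tmul _ _ _))
    (fun k a b => by
      change toRight ((k • a) ⊗ₜ[K] (1 : L)) ⊗ₜ[L] ((1 : L) ⊗ₜ[K] b) =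
        toRight (a ⊗ₜ[K] (1 : L)) ⊗ₜ[L] ((1 : L) ⊗ₜ[K] (k • b))
      have h1 : toRight ((k • a) ⊗ₜ[K] (1 : L)) =
          algebraMap K L k • toRight (a ⊗ₜ[K] (1 : L)) := by
        rw [smul_toRight]
        simp only [rightAct, TensorProduct.map_tmul, LinearMap.id_apply,
          LinearMap.mulRight_apply, one_mul]
        rw [TensorProduct.smul_tmul, Algebra.smul_def, mul_one]
      have h2 : (1 : L) ⊗ₜ[K] (k • b) = algebraMap K L k • ((1 : L) ⊗ₜ[K] b) := by
        rw [TensorProduct.smul_tmul', smul_eq_mul, mul_one, ← TensorProduct.smul_tmul,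
          Algebra.smul_def, mul_one]
      rw [h1, h2, TensorProduct.smul_tmul])

theorem coringComul_tmul (a b : L) : coringComul K L (a ⊗ₜ[K] b) =
    toRight (a ⊗ₜ[K] (1 : L)) ⊗ₜ[L] ((1 : L) ⊗ₜ[K] b) := rfl

variable {K L}

/-- `J` is a coideal of `L ⊗_K L`: `ε(J) = 0`, and `Δ(J)` lies in the sum of the images of
`J ⊗_L (L ⊗_K L)` and `(L ⊗_K L) ⊗_L J`. -/
def SubBimodule.IsCoideal (J : SubBimodule K L) : Prop :=
  (∀ x ∈ J.toAddSubgroup, coringCounit K L x = 0) ∧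
  ∀ x ∈ J.toAddSubgroup, coringComul K L x ∈ AddSubgroup.closure
    {t : CoringTensor K L | ∃ j ∈ J.toAddSubgroup, ∃ c : L ⊗[K] L,
      t = toRight j ⊗ₜ[L] c ∨ t = toRight c ⊗ₜ[L] j}

/-- The left action of `a ∈ L` on the quotient bimodule `(L ⊗_K L) / J`. -/
noncomputable def SubBimodule.quotLeftAct (J : SubBimodule K L) (a : L) :
    (L ⊗[K] L) ⧸ J.toAddSubgroup →+ (L ⊗[K] L) ⧸ J.toAddSubgroup :=
  QuotientAddGroup.map _ _ (leftAct a).toAddMonoidHom (J.left_mem' a)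

/-- The right action of `a ∈ L` on the quotient bimodule `(L ⊗_K L) / J`. -/
noncomputable def SubBimodule.quotRightAct (J : SubBimodule K L) (a : L) :
    (L ⊗[K] L) ⧸ J.toAddSubgroup →+ (L ⊗[K] L) ⧸ J.toAddSubgroup :=
  QuotientAddGroup.map _ _ (rightAct a).toAddMonoidHom (J.right_mem' a)

/-- The canonical surjection `π : L ⊗_K L → (L ⊗_K L) / J`. -/
noncomputable def SubBimodule.proj (J : SubBimodule K L) :
    L ⊗[K] L →+ (L ⊗[K] L) ⧸ J.toAddSubgroup :=
  QuotientAddGroup.mk' J.toAddSubgroup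

theorem SubBimodule.quotAct_eq_iff (J : SubBimodule K L) (a : L) :
    J.quotLeftAct a (J.proj (1 ⊗ₜ[K] 1)) = J.quotRightAct a (J.proj (1 ⊗ₜ[K] 1)) ↔
      a ⊗ₜ[K] (1 : L) - (1 : L) ⊗ₜ[K] a ∈ J.toAddSubgroup := by
  have h1 : J.quotLeftAct a (J.proj (1 ⊗ₜ[K] 1)) =
      QuotientAddGroup.mk' J.toAddSubgroup (a ⊗ₜ[K] (1 : L)) := by
    change QuotientAddGroup.mk' J.toAddSubgroup (leftAct a (1 ⊗ₜ[K] 1)) = _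
    simp [leftAct]
  have h2 : J.quotRightAct a (J.proj (1 ⊗ₜ[K] 1)) =
      QuotientAddGroup.mk' J.toAddSubgroup ((1 : L) ⊗ₜ[K] a) := by
    change QuotientAddGroup.mk' J.toAddSubgroup (rightAct a (1 ⊗ₜ[K] 1)) = _
    simp [rightAct]
  rw [h1, h2]
  exact QuotientAddGroup.eq_iff_sub_mem

/-- `M_J = {a ∈ L | a π(1 ⊗ 1) = π(1 ⊗ 1) a}`. -/
noncomputable def SubBimodule.toSubalgebra (J : SubBimodule K L) : Subalgebra K L where
  carrier := {a | J.quotLeftAct a (J.proj (1 ⊗ₜ[K] 1)) = J.quotRightAct a (J.proj (1 ⊗ₜ[K] 1))}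
  mul_mem' {a b} ha hb := by
    rw [Set.mem_ofPred_eq, J.quotAct_eq_iff] at ha hb ⊢
    have h := J.toAddSubgroup.add_mem (J.left_mem' a _ hb) (J.right_mem' b _ ha)
    simpa [leftAct, rightAct] using h
  add_mem' {a b} ha hb := by
    rw [Set.mem_ofPred_eq, J.quotAct_eq_iff] at ha hb ⊢
    have h := J.toAddSubgroup.add_mem ha hb
    rwa [show a ⊗ₜ[K] (1 : L) - (1 : L) ⊗ₜ[K] a + (b ⊗ₜ[K] (1 : L) - (1 : L) ⊗ₜ[K] b) =
      (a + b) ⊗ₜ[K] (1 : L) - (1 : L) ⊗ₜ[K] (a + b) by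
        rw [TensorProduct.add_tmul, TensorProduct.tmul_add]; abel] at h
  algebraMap_mem' k := by
    rw [Set.mem_ofPred_eq, J.quotAct_eq_iff]
    rw [Algebra.algebraMap_eq_smul_one, TensorProduct.smul_tmul, sub_self]
    exact J.toAddSubgroup.zero_mem

/-- The canonical surjection `L ⊗_K L → L ⊗_M L`, `a ⊗ b ↦ a ⊗ b`. -/
noncomputable def tensorProj (M : Subalgebra K L) : L ⊗[K] L →ₐ[K] L ⊗[M] L :=
  Algebra.TensorProduct.mapOfCompatibleSMul M K K L L

/-- `J_M = Ker (L ⊗_K L → L ⊗_M L)`. -/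
noncomputable def kerSubBimodule (M : Subalgebra K L) : SubBimodule K L where
  toAddSubgroup := (tensorProj M).toLinearMap.toAddMonoidHom.ker
  left_mem' a x hx := by
    have h : leftAct a x = (a ⊗ₜ[K] 1) * x := by
      clear hx
      induction x with
      | zero => simp
      | add x y hx hy => simp [mul_add, hx, hy]
      | tmul x y => simp [leftAct]
    change tensorProj M x = 0 at hx
    change tensorProj M (leftAct a x) = 0
    rw [h, map_mul, hx, mul_zero]
  right_mem' a x hx := by
    have h : rightAct a x = (1 ⊗ₜ[K] a) * x := smul_toRight K L a x |>.symm
    change tensorProj M x = 0 at hx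
    change tensorProj M (rightAct a x) = 0
    rw [h, map_mul, hx, mul_zero]

end Coring

/-! ### The action of `D` on `L ⊗_K L` -/

section TensorAction

variable (R : Type*) {D K L : Type*} [Field R] [Ring D] [HopfAlgebra R D]
  [CommRing K] [CommRing L] [Algebra R K] [Algebra R L] [Algebra K L] [IsScalarTower R K L]
  [Module D K] [Module D L] [IsScalarTower R D L]

/-- `∑ d₁ a ⊗ d₂ b ∈ L ⊗_K L`. -/
noncomputable def tensorActTmul (K : Type*) [CommRing K] [Algebra R K] [Algebra K L]
    [IsScalarTower R K L] (d : D) (a b : L) : L ⊗[K] L :=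
  Algebra.TensorProduct.mapOfCompatibleSMul K R R L L
    (TensorProduct.map (act R a) (act R b) (Coalgebra.comul (R := R) d))

theorem tensorActTmul_balanced [IsModuleAlgebra R D L] [IsInclusion D K L]
    (d : D) (k : K) (a b : L) :
    tensorActTmul R K d (k • a) b = tensorActTmul R K d a (k • b) := by
  set k' : L := algebraMap K L k with hk'
  let q : L ⊗[R] L →ₗ[R] L ⊗[K] L :=
    (Algebra.TensorProduct.mapOfCompatibleSMul K R R L L).toLinearMap
  let m (x y : L) : D ⊗[R] D →ₗ[R] L :=
    LinearMap.mul' R L ∘ₗ TensorProduct.map (act R x) (act R y)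
  have hm (x y : L) : act R (x * y) = m x y ∘ₗ (Coalgebra.comul : D →ₗ[R] D ⊗[R] D) :=
    LinearMap.ext fun d => IsModuleAlgebra.smul_mul d x y
  let G₁ : (D ⊗[R] D) ⊗[R] D →ₗ[R] L ⊗[K] L := q ∘ₗ TensorProduct.map (m a k') (act R b)
  let G₂ : D ⊗[R] (D ⊗[R] D) →ₗ[R] L ⊗[K] L := q ∘ₗ TensorProduct.map (act R a) (m k' b)
  have hG : G₁ = G₂ ∘ₗ (TensorProduct.assoc R D D D).toLinearMap := by
    refine TensorProduct.ext_threefold fun x y z => ?_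
    change ((x • a) * (y • k')) ⊗ₜ[K] (z • b) = (x • a) ⊗ₜ[K] ((y • k') * (z • b))
    rw [hk', ← IsInclusion.map_smul, mul_comm, ← Algebra.smul_def, ← Algebra.smul_def,
      TensorProduct.smul_tmul]
  have h₁ : tensorActTmul R K d (k • a) b =
      G₁ ((Coalgebra.comul (R := R)).rTensor D (Coalgebra.comul (R := R) d)) := by
    rw [Algebra.smul_def, mul_comm]
    change q (TensorProduct.map (act R (a * k')) (act R b) _) = q (TensorProduct.map _ _ _)
    rw [hm, LinearMap.rTensor, ← LinearMap.comp_apply (TensorProduct.map (m a k') (act R b)),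
      ← TensorProduct.map_comp, LinearMap.comp_id]
  have h₂ : tensorActTmul R K d a (k • b) =
      G₂ ((Coalgebra.comul (R := R)).lTensor D (Coalgebra.comul (R := R) d)) := by
    rw [Algebra.smul_def]
    change q (TensorProduct.map (act R a) (act R (k' * b)) _) = q (TensorProduct.map _ _ _)
    rw [hm, LinearMap.lTensor, ← LinearMap.comp_apply (TensorProduct.map (act R a) (m k' b)),
      ← TensorProduct.map_comp, LinearMap.comp_id]
  rw [h₁, h₂, hG, ← Coalgebra.coassoc_apply]
  rfl

/-- The action of `d ∈ D` on `L ⊗_K L`: `d (a ⊗ b) = ∑ d₁ a ⊗ d₂ b`. -/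
noncomputable def tensorAct [IsModuleAlgebra R D L] [IsInclusion D K L] (d : D) :
    L ⊗[K] L →+ L ⊗[K] L :=
  TensorProduct.liftAddHom
    (AddMonoidHom.mk' (fun a : L =>
      AddMonoidHom.mk' (fun b : L => tensorActTmul R K d a b)
        (fun b c => by
          have h : act (D := D) R (b + c) = act R b + act R c :=
            LinearMap.ext fun d => smul_add d b c
          simp only [tensorActTmul, h, TensorProduct.map_add_right, LinearMap.add_apply, map_add]))
      (fun a c => by
        ext b
        have h : act (D := D) R (a + c) = act R a + act R c :=
          LinearMap.ext fun d => smul_add d a c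
        simp [tensorActTmul, h, TensorProduct.map_add_left]))
    (fun k a b => tensorActTmul_balanced R d k a b)

theorem tensorAct_tmul [IsModuleAlgebra R D L] [IsInclusion D K L] (d : D) (a b : L)
    {ι : Type*} (r : Coalgebra.Repr R d ι) :
    tensorAct R d (a ⊗ₜ[K] b) =
      ∑ i ∈ r.index, (r.left i • a) ⊗ₜ[K] (r.right i • b) := by
  change tensorActTmul R K d a b = _
  rw [tensorActTmul, ← r.eq, map_sum, map_sum]
  rfl

variable (D K L) in
/-- The set `𝒞_{L/K}` of `D`-stable coideals of the `L`-coring `L ⊗_K L`. -/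
def stableCoideals [IsModuleAlgebra R D L] [IsInclusion D K L] : Set (SubBimodule K L) :=
  {J | J.IsCoideal ∧ ∀ (d : D), ∀ x ∈ J.toAddSubgroup, tensorAct R d x ∈ J.toAddSubgroup}

end TensorAction

end DModAlg

/-! Everything rests on `L` being a finite product of fields. By `subalgebra_eq_top`, `D` is
generated by its group-likes and its divided power sequences. Group-likes act by ring automorphisms,
and a divided power sequence acts through the multiplicative map `a ↦ ∑ dₙ(a) tⁿ` into power series.
Hence the nilradical of `L` is stable, so it is zero by simplicity, and an artinian reduced ring is
semisimple.

The generation theorem comes from the dual algebra `D*`, commutative by cocommutativity, acting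
locally finitely on `D`. An element splits into pieces killed by powers of maximal ideals.
Pointedness identifies those ideals with group-likes, and translation reduces to the component of
`1`. There the Birkhoff-Witt condition lets one subtract divided power monomials until nothing is
left (`mem_of_augIdeal_pow_smul`).

Recovering `M` from `J_M` is a splitting argument: `M` is semisimple, so `M → L` has an `M`-linear
retraction `p`, and `a ⊗ 1 = 1 ⊗ a` in `L ⊗_M L` forces `p(a) = a`. Recovering `J` from `M_J` is
descent. For `x = ∑ aᵢ ⊗ bᵢ` in `J`, the relations `V = {v | ∑ vᵢ ⊗ bᵢ ∈ J}` form a submodule of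
`Lⁿ`. The coideal condition gives `∑ vᵢ ⊗ μᵢ ∈ J` for `v ∈ V` and `μ ⟂ V`
(`SubBimodule.IsCoideal.sum_tmul_mem`). Row reduction then produces generators of `V` with entries
in `M_J` (`SubBimodule.exists_matrix`), and with them `x` visibly dies in `L ⊗_{M_J} L`. As `L` is
only a product of fields, the pivots are idempotents, and placing them in `M_J` needs the symmetry
`one_sub_tmul_mem`, where stability of `J` and simplicity of `L` enter.

Finally `M_J` is von Neumann regular, so its ideals are contracted from `L`. This transfers both the
artinian property and simplicity. -/

namespace DModAlg

/-! ### The dual algebra of `D` and its action on `D` -/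

section DualAlgebra

open WithConv Coalgebra

variable (R D : Type*) [Field R] [Ring D] [HopfAlgebra R D]

/-- The convolution algebra of linear functionals on `D`. -/
def DualConv : Type _ := WithConv (D →ₗ[R] R)

variable [IsCocomm R D]

noncomputable instance : CommRing (DualConv R D) :=
  inferInstanceAs (CommRing (WithConv (D →ₗ[R] R)))

noncomputable instance : Algebra R (DualConv R D) :=
  inferInstanceAs (Algebra R (WithConv (D →ₗ[R] R)))

/-- The elements of the convolution algebra, as linear functionals. -/
noncomputable def DualConv.lin : DualConv R D ≃ₗ[R] (D →ₗ[R] R) :=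
  WithConv.linearEquiv R (D →ₗ[R] R)

noncomputable instance : CoeFun (DualConv R D) fun _ => D → R := ⟨fun f => DualConv.lin R D f⟩

variable {R D}

theorem DualConv.mul_apply (f g : DualConv R D) {x : D} {ι : Type*} (r : Coalgebra.Repr R x ι) :
    (f * g) x = ∑ i ∈ r.index, f (r.left i) * g (r.right i) :=
  r.convMul_apply _ _

theorem DualConv.mul_eq (f g : DualConv R D) : DualConv.lin R D (f * g) =
    LinearMap.mul' R R ∘ₗ TensorProduct.map (DualConv.lin R D f) (DualConv.lin R D g) ∘ₗ comul :=
  rfl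

theorem DualConv.lin_one : DualConv.lin R D 1 = counit :=
  LinearMap.ext fun _ => rfl

@[simp]
theorem DualConv.one_apply (x : D) : (1 : DualConv R D) x = counit (R := R) x := rfl

/-- The operator `x ↦ ∑ f(x₂) x₁` on `D`. -/
noncomputable def hit (f : DualConv R D) : D →ₗ[R] D :=
  (TensorProduct.rid R D).toLinearMap ∘ₗ (DualConv.lin R D f).lTensor D ∘ₗ comul

theorem hit_repr (f : DualConv R D) {x : D} {ι : Type*} (r : Coalgebra.Repr R x ι) :
    hit f x = ∑ i ∈ r.index, f (r.right i) • r.left i := by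
  simp [hit, ← r.eq]

theorem hit_of_comul_eq (f : DualConv R D) {x : D} {ι : Type*} {s : Finset ι} {u v : ι → D}
    (h : comul (R := R) x = ∑ i ∈ s, u i ⊗ₜ[R] v i) : hit f x = ∑ i ∈ s, f (v i) • u i := by
  simp [hit, h]

theorem hit_mul (f g : DualConv R D) (x : D) : hit (f * g) x = hit f (hit g x) := by
  have key : (TensorProduct.rid R D).toLinearMap ∘ₗ (DualConv.lin R D f).lTensor D ∘ₗ
      (TensorProduct.rid R (D ⊗[R] D)).toLinearMap ∘ₗ (DualConv.lin R D g).lTensor (D ⊗[R] D) =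
      (TensorProduct.rid R D).toLinearMap ∘ₗ (LinearMap.mul' R R ∘ₗ
        TensorProduct.map (DualConv.lin R D f) (DualConv.lin R D g)).lTensor D ∘ₗ
          (TensorProduct.assoc R D D D).toLinearMap := by
    ext a b c
    simp [mul_smul, smul_comm (g c) (f b) a]
  have h1 : hit (f * g) x = ((TensorProduct.rid R D).toLinearMap ∘ₗ (LinearMap.mul' R R ∘ₗ
        TensorProduct.map (DualConv.lin R D f) (DualConv.lin R D g)).lTensor D)
          (comul.lTensor D (comul (R := R) x)) := by
    rw [hit, DualConv.mul_eq]
    simp only [LinearMap.comp_apply, ← LinearMap.lTensor_comp_apply]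
    rfl
  have h2 (t : D ⊗[R] D) :
      comul (R := R) ((TensorProduct.rid R D) ((DualConv.lin R D g).lTensor D t)) =
      TensorProduct.rid R (D ⊗[R] D)
        ((DualConv.lin R D g).lTensor (D ⊗[R] D) (comul.rTensor D t)) := by
    induction t with
    | zero => simp
    | add a b ha hb => simp only [map_add, ha, hb]
    | tmul a b => simp
  rw [h1, ← Coalgebra.coassoc_apply]
  have := LinearMap.congr_fun key (comul.rTensor D (comul (R := R) x))
  simp only [LinearMap.comp_apply, LinearEquiv.coe_coe] at this ⊢
  rw [← this, hit, hit]
  simp only [LinearMap.comp_apply, LinearEquiv.coe_coe, h2]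

theorem hit_one (x : D) : hit (1 : DualConv R D) x = x := by
  rw [hit, DualConv.lin_one]
  simp

/-- The convolution algebra of functionals acts on `D` by `f • x = ∑ f(x₂) x₁`. -/
noncomputable instance dualModule : Module (DualConv R D) D where
  smul f x := hit f x
  one_smul := hit_one
  mul_smul := hit_mul
  smul_zero f := map_zero (hit f)
  smul_add f := map_add (hit f)
  add_smul f g x := by
    change hit (f + g) x = hit f x + hit g x
    simp [hit, LinearMap.lTensor_add]
  zero_smul x := by
    change hit 0 x = 0
    simp [hit]

theorem dual_smul_def (f : DualConv R D) (x : D) : f • x = hit f x := rfl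

instance : IsScalarTower R (DualConv R D) D where
  smul_assoc r f x := by simp [dual_smul_def, hit, LinearMap.lTensor_smul]

theorem dual_smul_smul (f : DualConv R D) (r : R) (x : D) : f • r • x = r • f • x :=
  map_smul (hit f) r x

theorem counit_dual_smul (f : DualConv R D) (x : D) : counit (R := R) (f • x) = f x := by
  conv_rhs => rw [← one_mul f, DualConv.mul_apply _ _ (ℛ R x)]
  rw [dual_smul_def, hit_repr f (ℛ R x)]
  simp [mul_comm]

theorem dual_mul_apply (f g : DualConv R D) (x : D) : (f * g) x = f (g • x) := by
  rw [← counit_dual_smul, mul_smul, counit_dual_smul]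

theorem dual_smul_groupLike (f : DualConv R D) {g : D} (hg : IsGroupLikeElem R g) :
    f • g = f g • g := by
  simp [dual_smul_def, hit, hg.comul_eq_tmul_self]

theorem dual_smul_one (f : DualConv R D) : f • (1 : D) = f 1 • (1 : D) :=
  dual_smul_groupLike f .one

/-- The translate of a functional by an element. -/
noncomputable def DualConv.translate (g : D) (f : DualConv R D) : DualConv R D :=
  (DualConv.lin R D).symm (DualConv.lin R D f ∘ₗ LinearMap.mulLeft R g)

@[simp]
theorem DualConv.translate_apply (g x : D) (f : DualConv R D) : translate g f x = f (g * x) := by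
  simp [translate]

/-- `Δ(gx)` is `Δ(x)` with both legs multiplied by `g`. This is what later carries the component of
a group-like to that of `1`. -/
theorem dual_smul_groupLike_mul (f : DualConv R D) {g : D} (hg : IsGroupLikeElem R g) (x : D) :
    f • (g * x) = g * f.translate g • x := by
  have h : comul (R := R) (g * x) =
      ∑ i ∈ (ℛ R x).index, (g * (ℛ R x).left i) ⊗ₜ[R] (g * (ℛ R x).right i) := by
    rw [Bialgebra.comul_mul, hg.comul_eq_tmul_self]
    nth_rw 1 [← (ℛ R x).eq]
    simp [Finset.mul_sum]
  rw [dual_smul_def, dual_smul_def, hit_of_comul_eq f h, hit_repr _ (ℛ R x), Finset.mul_sum]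
  simp

omit [IsCocomm R D] in
/-- Functionals on the second factor separate the points of `V ⊗ D`. -/
theorem eq_zero_of_forall_lTensor {V : Type*} [AddCommGroup V] [Module R V] {t : V ⊗[R] D}
    (h : ∀ f : D →ₗ[R] R, TensorProduct.rid R V (f.lTensor V t) = 0) : t = 0 := by
  classical
  let b := Module.Basis.ofVectorSpace R D
  apply (TensorProduct.equivFinsuppOfBasisRight (M := V) b).injective
  rw [map_zero]
  ext i
  have key : (Finsupp.lapply i) ∘ₗ (TensorProduct.equivFinsuppOfBasisRight (M := V) b).toLinearMap =
      (TensorProduct.rid R V).toLinearMap ∘ₗ (b.coord i).lTensor V := by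
    ext m n
    simp
  have := LinearMap.congr_fun key t
  simp only [LinearMap.comp_apply, LinearEquiv.coe_coe, h] at this
  simpa using this

theorem eq_of_forall_dual {x y : D} (h : ∀ f : DualConv R D, f x = f y) : x = y := by
  rw [← sub_eq_zero, ← Module.forall_dual_apply_eq_zero_iff R]
  intro f
  rw [map_sub, sub_eq_zero]
  simpa using h ((DualConv.lin R D).symm f)

/-- The orbit map `f ↦ f • x`. -/
noncomputable def orbitMap (x : D) : DualConv R D →ₗ[R] D :=
  (LinearMap.toSpanSingleton (DualConv R D) D x).restrictScalars R

@[simp]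
theorem orbitMap_apply (x : D) (f : DualConv R D) : orbitMap x f = f • x := rfl

/-- Local finiteness: the orbit lies in the span of the left legs of any one expression of `Δ(x)`.
-/
instance finite_range_orbitMap (x : D) :
    Module.Finite R (LinearMap.range (orbitMap (R := R) x)) := by
  let W : Submodule R D := Submodule.span R ((ℛ R x).left '' (ℛ R x).index)
  have : Module.Finite R W := Module.Finite.span_of_finite R ((Finset.finite_toSet _).image _)
  refine Submodule.finiteDimensional_of_le (S₂ := W) ?_
  rintro _ ⟨f, rfl⟩
  change hit f x ∈ W
  rw [hit_repr f (ℛ R x)]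
  exact Submodule.sum_mem _ fun i hi =>
    W.smul_mem _ (Submodule.subset_span ⟨i, hi, rfl⟩)

end DualAlgebra

/-! ### Divided power families in several variables -/

section Families

open Coalgebra

variable {R D : Type*} [Field R] [Ring D] [HopfAlgebra R D]

/-- A divided power family in `k` variables. -/
structure IsDividedPowerFamily (R : Type*) {D : Type*} [Field R] [Ring D] [HopfAlgebra R D] {k : ℕ}
    (c : (Fin k → ℕ) → D) : Prop where
  zero : c 0 = 1
  comul : ∀ α, comul (R := R) (c α) = ∑ β ∈ Finset.Iic α, c β ⊗ₜ[R] c (α - β)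

theorem sum_Iic_cons {k : ℕ} {M : Type*} [AddCommMonoid M] (α : Fin (k + 1) → ℕ)
    (F : ℕ → (Fin k → ℕ) → M) :
    ∑ β ∈ Finset.Iic α, F (β 0) (Fin.tail β) =
      ∑ i ∈ Finset.range (α 0 + 1), ∑ β ∈ Finset.Iic (Fin.tail α), F i β := by
  rw [← Finset.sum_product']
  refine Finset.sum_nbij' (fun β => (β 0, Fin.tail β)) (fun p => Fin.cons p.1 p.2) ?_ ?_ ?_ ?_ ?_
  · intro β hβ
    rw [Finset.mem_Iic] at hβ
    simp only [Finset.mem_product, Finset.mem_range, Finset.mem_Iic]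
    exact ⟨Nat.lt_succ_of_le (hβ 0), fun i => hβ i.succ⟩
  · rintro ⟨i, β⟩ h
    simp only [Finset.mem_product, Finset.mem_range, Finset.mem_Iic] at h ⊢
    intro j
    refine Fin.cases ?_ (fun j => ?_) j
    · exact Nat.le_of_lt_succ h.1
    · exact h.2 j
  · intro β _
    simp
  · rintro ⟨i, β⟩ _
    simp
  · intro β _
    rfl

theorem IsDividedPowerFamily.cons {k : ℕ} {c : (Fin k → ℕ) → D} (hc : IsDividedPowerFamily R c)
    {d : ℕ → D} (hd : IsDividedPowerSeq R D d) :
    IsDividedPowerFamily R fun α : Fin (k + 1) → ℕ => d (α 0) * c (Fin.tail α) where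
  zero := by
    have : Fin.tail (0 : Fin (k + 1) → ℕ) = 0 := rfl
    simp [this, hc.zero, hd.1]
  comul α := by
    rw [Bialgebra.comul_mul, hd.2.2, hc.comul, Finset.sum_mul_sum]
    simp only [Algebra.TensorProduct.tmul_mul_tmul]
    rw [← sum_Iic_cons α fun i β => (d i * c β) ⊗ₜ[R] (d (α 0 - i) * c (Fin.tail α - β))]
    rfl

/-- Ordered products of one sequence per primitive element work, since `Δ` is multiplicative; the
sequences need not commute with one another. -/
theorem exists_dividedPowerFamily (hBW : IsBirkhoffWitt R D) {S : Subalgebra R D}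
    (hS : ∀ d : ℕ → D, IsDividedPowerSeq R D d → ∀ n, d n ∈ S) :
    ∀ (k : ℕ) (x : Fin k → D), (∀ i, IsPrimitive R D (x i)) →
      ∃ c : (Fin k → ℕ) → D, IsDividedPowerFamily R c ∧ (∀ i, c (Pi.single i 1) = x i) ∧
        ∀ α, c α ∈ S
  | 0, x, _ => by
    refine ⟨fun _ => 1, ⟨rfl, fun α => ?_⟩, fun i => i.elim0, fun _ => S.one_mem⟩
    have : Finset.Iic α = {α} := by
      ext β
      simp [Subsingleton.elim β α]
    rw [this]
    simp [Algebra.TensorProduct.one_def]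
  | k + 1, x, hx => by
    obtain ⟨c, hc, hcx, hcS⟩ := exists_dividedPowerFamily hBW hS k (Fin.tail x)
      fun i => hx i.succ
    obtain ⟨d, hd, hdx⟩ := hBW (x 0) (hx 0)
    refine ⟨_, hc.cons hd, fun i => ?_, fun α => S.mul_mem (hS d hd _) (hcS _)⟩
    refine Fin.cases ?_ (fun j => ?_) i
    · have : Fin.tail (Pi.single 0 1 : Fin (k + 1) → ℕ) = 0 := by
        ext j
        simp [Fin.tail]
      simp [this, hc.zero, hdx]
    · have : Fin.tail (Pi.single j.succ 1 : Fin (k + 1) → ℕ) = Pi.single j 1 := by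
        ext l
        simp [Fin.tail, Pi.single_apply]
      have h0 : (Pi.single j.succ 1 : Fin (k + 1) → ℕ) 0 = 0 := by
        simp
      simp only [this, h0, hd.1, hcx, one_mul]
      rfl

section Filtration

variable {k : ℕ} {c : (Fin k → ℕ) → D}

variable (R) in
/-- The span of the members of degree less than `j` of a family. -/
def degreeLT (c : (Fin k → ℕ) → D) (j : ℕ) : Submodule R D :=
  Submodule.span R (c '' {β | ∑ i, β i < j})

theorem mem_degreeLT {β : Fin k → ℕ} {j : ℕ} (h : ∑ i, β i < j) : c β ∈ degreeLT R c j :=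
  Submodule.subset_span ⟨β, h, rfl⟩

theorem degreeLT_zero : degreeLT R c 0 = ⊥ := by
  simp [degreeLT]

theorem sum_lt_of_le_of_ne {α β : Fin k → ℕ} (h : β ≤ α) (hne : β ≠ α) :
    ∑ i, β i < ∑ i, α i := by
  obtain ⟨i, hi⟩ := Function.ne_iff.mp hne
  exact Finset.sum_lt_sum (fun i _ => h i) ⟨i, Finset.mem_univ i, lt_of_le_of_ne (h i) hi⟩

end Filtration

end Families

/-! ### Powers of the augmentation ideal and duality with divided powers -/

section Conilpotent

open Coalgebra

variable {R D : Type*} [Field R] [Ring D] [HopfAlgebra R D] [Coalgebra.IsCocomm R D]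

/-- The ideal of functionals vanishing at a group-like element. -/
def groupLikeIdeal {g : D} (hg : IsGroupLikeElem R g) : Ideal (DualConv R D) where
  carrier := {f | f g = 0}
  add_mem' {f f'} hf hf' := by
    rw [Set.mem_ofPred_eq] at *
    rw [map_add, LinearMap.add_apply, hf, hf', add_zero]
  zero_mem' := by simp
  smul_mem' f f' hf := by
    rw [Set.mem_ofPred_eq] at *
    rw [smul_eq_mul, dual_mul_apply, dual_smul_groupLike f' hg, hf, zero_smul, map_zero]

theorem mem_groupLikeIdeal {g : D} {hg : IsGroupLikeElem R g} {f : DualConv R D} :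
    f ∈ groupLikeIdeal hg ↔ f g = 0 := Iff.rfl

variable (R D) in
/-- The ideal of functionals vanishing at `1`. -/
abbrev augIdeal : Ideal (DualConv R D) := groupLikeIdeal (IsGroupLikeElem.one (R := R) (A := D))

theorem sub_smul_one_mem_augIdeal (f : DualConv R D) : f - f 1 • 1 ∈ augIdeal R D := by
  rw [mem_groupLikeIdeal]
  simp

theorem eq_smul_one_of_augIdeal_smul {y : D} (h : ∀ f ∈ augIdeal R D, f • y = 0) :
    y = counit (R := R) y • (1 : D) := by
  refine eq_of_forall_dual (R := R) fun f => ?_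
  have h1 := h _ (sub_smul_one_mem_augIdeal f)
  rw [sub_smul, sub_eq_zero, smul_assoc, one_smul] at h1
  rw [← counit_dual_smul, h1]
  simp [mul_comm]

/-- With `p` the reduced element, the hypothesis yields `f • p = f(p) 1 + f(1) p` for every
functional `f`. Functionals on the second leg separate tensors, so this determines `Δ(p)`. -/
theorem isPrimitive_of_augIdeal_sq_smul {y : D} (h : ∀ f ∈ augIdeal R D ^ 2, f • y = 0) :
    IsPrimitive R D (y - counit (R := R) y • (1 : D)) := by
  have h1 : ∀ f ∈ augIdeal R D, f • y = f y • (1 : D) := fun f hf => by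
    rw [← counit_dual_smul]
    refine eq_smul_one_of_augIdeal_smul fun g hg => ?_
    rw [← mul_smul]
    exact h _ (by rw [pow_two]; exact Ideal.mul_mem_mul hg hf)
  set p := y - counit (R := R) y • (1 : D) with hp
  have h2 : ∀ f : DualConv R D, f • p = f p • (1 : D) + f 1 • p := fun f => by
    have h3 := h1 _ (sub_smul_one_mem_augIdeal f)
    rw [sub_smul, sub_eq_iff_eq_add, smul_assoc, one_smul] at h3
    rw [hp, smul_sub, dual_smul_smul, dual_smul_one, h3]
    simp [sub_smul, smul_sub, smul_smul, mul_comm]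
    abel
  unfold IsPrimitive
  rw [← sub_eq_zero]
  refine eq_zero_of_forall_lTensor fun f => ?_
  have h3 := h2 ((DualConv.lin R D).symm f)
  rw [dual_smul_def] at h3
  rw [map_sub, map_sub, sub_eq_zero]
  simp only [hit, LinearEquiv.apply_symm_apply] at h3
  refine h3.trans ?_
  simp [add_comm]

variable {k : ℕ} {c : (Fin k → ℕ) → D}

theorem IsDividedPowerFamily.dual_smul (hc : IsDividedPowerFamily R c) (f : DualConv R D)
    (α : Fin k → ℕ) : f • c α = ∑ β ∈ Finset.Iic α, f (c (α - β)) • c β := by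
  rw [dual_smul_def, hit_of_comul_eq f (hc.comul α)]

theorem IsDividedPowerFamily.dual_smul_mem (hc : IsDividedPowerFamily R c) (f : DualConv R D)
    {j : ℕ} {y : D} (hy : y ∈ degreeLT R c j) : f • y ∈ degreeLT R c j := by
  induction hy using Submodule.span_induction with
  | mem x hx =>
    obtain ⟨α, hα, rfl⟩ := hx
    rw [hc.dual_smul]
    refine Submodule.sum_mem _ fun β hβ => ?_
    rw [Finset.mem_Iic] at hβ
    exact Submodule.smul_mem _ _ (mem_degreeLT
      (lt_of_le_of_lt (Finset.sum_le_sum fun i _ => hβ i) hα))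
  | zero => rw [smul_zero]; exact Submodule.zero_mem _
  | add x y _ _ hx hy => rw [smul_add]; exact Submodule.add_mem _ hx hy
  | smul r x _ hx => rw [dual_smul_smul]; exact Submodule.smul_mem _ _ hx

/-- The only term of top degree in `f • c α` has coefficient `f(c 0) = f(1) = 0`. -/
theorem IsDividedPowerFamily.augIdeal_smul_mem (hc : IsDividedPowerFamily R c) {f : DualConv R D}
    (hf : f ∈ augIdeal R D) {j : ℕ} {y : D} (hy : y ∈ degreeLT R c (j + 1)) :
    f • y ∈ degreeLT R c j := by
  induction hy using Submodule.span_induction with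
  | mem x hx =>
    obtain ⟨α, hα, rfl⟩ := hx
    rw [hc.dual_smul]
    refine Submodule.sum_mem _ fun β hβ => ?_
    rw [Finset.mem_Iic] at hβ
    by_cases h : β = α
    · rw [h, tsub_self, hc.zero, mem_groupLikeIdeal.mp hf, zero_smul]
      exact Submodule.zero_mem _
    · exact Submodule.smul_mem _ _ (mem_degreeLT
        (lt_of_lt_of_le (sum_lt_of_le_of_ne hβ h) (Nat.le_of_lt_succ hα)))
  | zero => rw [smul_zero]; exact Submodule.zero_mem _
  | add x y _ _ hx hy => rw [smul_add]; exact Submodule.add_mem _ hx hy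
  | smul r x _ hx => rw [dual_smul_smul]; exact Submodule.smul_mem _ _ hx

theorem IsDividedPowerFamily.pow_smul_mem (hc : IsDividedPowerFamily R c) (i : ℕ) :
    ∀ {f : DualConv R D}, f ∈ augIdeal R D ^ i → ∀ {j : ℕ} {y : D},
      y ∈ degreeLT R c (j + i) → f • y ∈ degreeLT R c j := by
  induction i with
  | zero => exact fun _ => hc.dual_smul_mem _
  | succ i ih =>
    intro f hf j y hy
    rw [pow_succ] at hf
    induction hf using Submodule.mul_induction_on' with
    | mem_mul_mem a ha b hb =>
      rw [mul_smul]
      exact ih ha (hc.augIdeal_smul_mem hb hy)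
    | add a _ b _ ha hb => rw [add_smul]; exact Submodule.add_mem _ ha hb

/-- Monomials in functionals `ξ i`. -/
noncomputable def monomialDual (ξ : Fin k → DualConv R D) (α : Fin k → ℕ) : DualConv R D :=
  ∏ i, ξ i ^ α i

theorem monomialDual_add_single (ξ : Fin k → DualConv R D) (α : Fin k → ℕ) (i : Fin k) :
    monomialDual ξ (α + Pi.single i 1) = monomialDual ξ α * ξ i := by
  simp only [monomialDual, Pi.add_apply, pow_add, Finset.prod_mul_distrib]
  congr 1
  rw [Finset.prod_eq_single i] <;> simp +contextual

theorem monomialDual_mem {ξ : Fin k → DualConv R D} (hξ : ∀ i, ξ i ∈ augIdeal R D)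
    (α : Fin k → ℕ) : monomialDual ξ α ∈ augIdeal R D ^ ∑ i, α i := by
  rw [← Finset.prod_pow_eq_pow_sum]
  exact Ideal.prod_mem_prod fun i _ => Ideal.pow_mem_pow (hξ i) _

theorem exists_eq_add_single {n : ℕ} {α : Fin k → ℕ} (h : ∑ i, α i = n + 1) :
    ∃ (β : Fin k → ℕ) (i : Fin k), ∑ i, β i = n ∧ α = β + Pi.single i 1 := by
  obtain ⟨i, -, hi⟩ := Finset.exists_ne_zero_of_sum_ne_zero (by rw [h]; exact Nat.succ_ne_zero n)
  have h1 : α = (α - Pi.single i 1) + Pi.single i 1 := by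
    refine (tsub_add_cancel_of_le fun j => ?_).symm
    by_cases hj : j = i
    · subst hj
      simpa using Nat.one_le_iff_ne_zero.mpr hi
    · simp [hj]
  refine ⟨α - Pi.single i 1, i, ?_, h1⟩
  rw [h1] at h
  simpa [Finset.sum_add_distrib] using h

/-- In a fixed degree, monomials in the `ξ i` are dual to the divided powers. No factorials occur
because the coefficients of `Δ(c α)` are all one, so the characteristic is irrelevant. -/
theorem IsDividedPowerFamily.monomialDual_apply (hc : IsDividedPowerFamily R c)
    {ξ : Fin k → DualConv R D} (hξ : ∀ i, ξ i ∈ augIdeal R D)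
    (hξc : ∀ i j, ξ i (c (Pi.single j 1)) = if i = j then 1 else 0) (n : ℕ) :
    ∀ β α : Fin k → ℕ, ∑ i, β i = n → ∑ i, α i = n →
      monomialDual ξ β (c α) = if β = α then 1 else 0 := by
  induction n with
  | zero =>
    intro β α hβ hα
    have h0 : ∀ γ : Fin k → ℕ, ∑ i, γ i = 0 → γ = 0 := fun γ h => by
      ext i
      simpa using (Finset.sum_eq_zero_iff.mp h) i (Finset.mem_univ i)
    rw [h0 β hβ, h0 α hα, hc.zero]
    simp [monomialDual]
  | succ n ih =>
    intro β α hβ hα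
    obtain ⟨γ, i, hγ, rfl⟩ := exists_eq_add_single hβ
    rw [monomialDual_add_single, dual_mul_apply, hc.dual_smul, map_sum]
    have key : ∀ δ ∈ Finset.Iic α, monomialDual ξ γ (ξ i (c (α - δ)) • c δ) =
        if γ = δ then (if γ + Pi.single i 1 = α then 1 else 0) else 0 := by
      intro δ hδ
      rw [Finset.mem_Iic] at hδ
      rw [map_smul, smul_eq_mul]
      have hsum : ∑ i, (α - δ) i + ∑ i, δ i = n + 1 := by
        rw [← Finset.sum_add_distrib, ← hα]
        exact Finset.sum_congr rfl fun i _ => Nat.sub_add_cancel (hδ i)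
      -- Below degree `n`, `ξ^γ ∈ I^n` annihilates `c δ`. In degree `n`, `α - δ` is a unit vector
      -- and induction applies. Above it only `δ = α` remains, with coefficient `ξ i 1 = 0`.
      rcases lt_trichotomy (∑ i, δ i) n with h | h | h
      · rw [if_neg (fun h' => by subst h'; omega)]
        have h1 := hc.pow_smul_mem n (hγ ▸ monomialDual_mem hξ γ) (j := 0)
          (mem_degreeLT (R := R) (c := c) (by omega : ∑ i, δ i < 0 + n))
        rw [degreeLT_zero, Submodule.mem_bot] at h1
        rw [← counit_dual_smul (monomialDual ξ γ), h1, map_zero, mul_zero]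
      · rw [ih γ δ hγ h]
        obtain ⟨ζ, j, hζ, hj⟩ := exists_eq_add_single (n := 0) (α := α - δ) (by omega)
        have hζ0 : ζ = 0 := by
          ext i
          simpa using (Finset.sum_eq_zero_iff.mp hζ) i (Finset.mem_univ i)
        rw [hζ0, zero_add] at hj
        by_cases hγδ : γ = δ
        · subst hγδ
          rw [hj, hξc, if_pos rfl, if_pos rfl, mul_one]
          have : α = γ + Pi.single j 1 := by rw [← hj, add_tsub_cancel_of_le hδ]
          rw [this]
          by_cases hij : i = j
          · simp [hij]
          · rw [if_neg hij, if_neg]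
            intro h'
            have := congrFun (add_left_cancel h') i
            simp [hij] at this
        · rw [if_neg hγδ, if_neg hγδ, mul_zero]
      · have hδα : δ = α := by
          by_contra hne
          have := sum_lt_of_le_of_ne hδ hne
          omega
        rw [if_neg (fun h' => by subst h'; omega), hδα, tsub_self, hc.zero,
          mem_groupLikeIdeal.mp (hξ i), zero_mul]
    rw [Finset.sum_congr rfl key, Finset.sum_ite_eq]
    by_cases h : γ + Pi.single i 1 = α
    · rw [if_pos h, if_pos]
      rw [Finset.mem_Iic, ← h]
      exact le_self_add
    · simp [h]

end Conilpotent

/-! ### Conilpotent elements are generated by divided powers -/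

section Generation

open Coalgebra

variable {R D : Type*} [Field R] [Ring D] [HopfAlgebra R D]

theorem IsPrimitive.counit_eq_zero {x : D} (hx : IsPrimitive R D x) : counit (R := R) x = 0 := by
  have h := congrArg (TensorProduct.rid R D) (Coalgebra.lTensor_counit_comul (R := R) x)
  rw [hx] at h
  simp only [map_add, LinearMap.lTensor_tmul, TensorProduct.rid_tmul, Bialgebra.counit_one,
    one_smul, add_eq_left] at h
  simpa using congrArg (counit (R := R)) h

variable (R D) in
/-- The subspace of primitive elements. -/
def primitives : Submodule R D where
  carrier := {x | IsPrimitive R D x}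
  add_mem' {x y} hx hy := by
    rw [Set.mem_ofPred_eq, IsPrimitive] at *
    rw [map_add, hx, hy, TensorProduct.add_tmul, TensorProduct.tmul_add]
    abel
  zero_mem' := by simp [IsPrimitive]
  smul_mem' r x hx := by
    rw [Set.mem_ofPred_eq, IsPrimitive] at *
    rw [map_smul, hx, smul_add, TensorProduct.smul_tmul', TensorProduct.tmul_smul]

variable [IsCocomm R D]

theorem exists_dual_family {k : ℕ} {x : Fin k → D} (hx : LinearIndependent R x)
    (hp : ∀ i, IsPrimitive R D (x i)) :
    ∃ ξ : Fin k → DualConv R D, (∀ i, ξ i ∈ augIdeal R D) ∧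
      ∀ i j, ξ i (x j) = if i = j then 1 else 0 := by
  have h : ∀ i, ∃ f : D →ₗ[R] R, f ∘ₗ (Submodule.span R (Set.range x)).subtype =
      (Module.Basis.span hx).coord i := fun i => LinearMap.exists_extend _
  choose f hf using h
  have hfx : ∀ i j, f i (x j) = if i = j then 1 else 0 := fun i j => by
    have := LinearMap.congr_fun (hf i) (Module.Basis.span hx j)
    simpa [Module.Basis.span_apply, Finsupp.single_apply, eq_comm] using this
  -- Subtracting a multiple of the counit forces vanishing at `1` without changing values on
  -- primitives, where the counit is zero.
  refine ⟨fun i => (DualConv.lin R D).symm (f i) - f i 1 • 1, fun i => ?_, fun i j => ?_⟩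
  · rw [mem_groupLikeIdeal]
    simp
  · simp [hfx, (hp j).counit_eq_zero]

/-- The conilpotent elements lie in every subalgebra containing all divided power sequences. -/
theorem mem_of_augIdeal_pow_smul (hBW : IsBirkhoffWitt R D) {S : Subalgebra R D}
    (hS : ∀ d : ℕ → D, IsDividedPowerSeq R D d → ∀ n, d n ∈ S) (m : ℕ) :
    ∀ y : D, (∀ f ∈ augIdeal R D ^ (m + 1), f • y = 0) → y ∈ S := by
  induction m with
  | zero =>
    intro y hy
    rw [zero_add, pow_one] at hy
    rw [eq_smul_one_of_augIdeal_smul hy]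
    exact S.smul_mem S.one_mem _
  | succ m ih =>
    intro y hy
    let red : D →ₗ[R] D := LinearMap.id - (counit (R := R) (A := D)).smulRight 1
    -- Only primitives coming from the orbit of `y` matter; they form a finite-dimensional space
    -- even if the space of all primitives is infinite-dimensional.
    let V : Submodule R D := primitives R D ⊓ (LinearMap.range (orbitMap (R := R) y)).map red
    have hV : Module.Finite R V := Submodule.finiteDimensional_inf_right _ _
    let b := Module.finBasis R V
    let x : Fin (Module.finrank R V) → D := fun i => b i
    have hx : LinearIndependent R x := b.linearIndependent.map' V.subtype V.ker_subtype
    have hxp : ∀ i, IsPrimitive R D (x i) := fun i => (b i).2.1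
    obtain ⟨ξ, hξ, hξx⟩ := exists_dual_family hx hxp
    obtain ⟨c, hc, hcx, hcS⟩ := exists_dividedPowerFamily hBW hS _ x hxp
    have hξc : ∀ i j, ξ i (c (Pi.single j 1)) = if i = j then 1 else 0 := fun i j => by
      rw [hcx, hξx]
    have hVc : V ≤ degreeLT R c 2 := by
      intro v hv
      have h1 := congrArg V.subtype (b.sum_repr ⟨v, hv⟩)
      rw [map_sum] at h1
      change _ = v at h1
      rw [← h1]
      refine Submodule.sum_mem _ fun i _ => ?_
      rw [map_smul]
      change _ • x i ∈ _
      rw [← hcx]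
      exact Submodule.smul_mem _ _ (mem_degreeLT (by simp))
    -- `I²` kills `f • y`, which is therefore a scalar plus an element of `V`.
    have hy2 : ∀ f ∈ augIdeal R D ^ m, f • y ∈ degreeLT R c 2 := by
      intro f hf
      have h1 : IsPrimitive R D (red (f • y)) :=
        isPrimitive_of_augIdeal_sq_smul fun g hg => by
          rw [LinearMap.id_apply, ← mul_smul]
          exact hy _ (by rw [add_assoc, add_comm, pow_add]; exact Ideal.mul_mem_mul hg hf)
      have h2 : f • y = red (f • y) + counit (R := R) (f • y) • (1 : D) := by
        simp [red]
      rw [h2]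
      refine Submodule.add_mem _ (hVc ⟨h1, Submodule.mem_map_of_mem ⟨f, rfl⟩⟩) ?_
      rw [← hc.zero]
      exact Submodule.smul_mem _ _ (mem_degreeLT (by simp))
    set s : Finset (Fin (Module.finrank R V) → ℕ) := Finset.piAntidiag Finset.univ (m + 1)
    have hs : ∀ α, α ∈ s ↔ ∑ i, α i = m + 1 := fun α => by simp [s]
    -- The leading part of `y`, read off by duality: all degree `m + 1` monomials in the `ξ i` then
    -- vanish on `y - z`. The goal is that `I^(m+1)` kills `y - z`.
    set z : D := ∑ α ∈ s, monomialDual ξ α y • c α with hz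
    have hzS : z ∈ S := S.sum_mem fun α _ => S.smul_mem (hcS α) _
    have hzc : z ∈ degreeLT R c (m + 2) := Submodule.sum_mem _ fun α hα =>
      Submodule.smul_mem _ _ (mem_degreeLT (by have := (hs α).mp hα; omega))
    have h1 : ∀ f ∈ augIdeal R D ^ (m + 2), f • (y - z) = 0 := by
      intro f hf
      have := hc.pow_smul_mem (m + 2) hf (j := 0) (y := z) (by rwa [zero_add])
      rw [degreeLT_zero, Submodule.mem_bot] at this
      rw [smul_sub, hy f hf, this, sub_zero]
    have h2 : ∀ f ∈ augIdeal R D ^ m, f • (y - z) ∈ degreeLT R c 2 := fun f hf => by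
      rw [smul_sub]
      exact Submodule.sub_mem _ (hy2 f hf) (hc.pow_smul_mem m hf (by rwa [add_comm]))
    have h3 : ∀ β : Fin (Module.finrank R V) → ℕ, ∑ i, β i = m + 1 →
        monomialDual ξ β (y - z) = 0 := by
      intro β hβ
      rw [map_sub, sub_eq_zero, hz, map_sum]
      have : ∀ α ∈ s, monomialDual ξ β (monomialDual ξ α y • c α) =
          if β = α then monomialDual ξ α y else 0 := fun α hα => by
        rw [map_smul, hc.monomialDual_apply hξ hξc _ β α hβ ((hs α).mp hα)]
        simp
      rw [Finset.sum_congr rfl this, Finset.sum_ite_eq, if_pos ((hs β).mpr hβ)]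
    have h4 : ∀ g ∈ augIdeal R D, ∀ w ∈ degreeLT R c 2, g w = ∑ i, g (x i) * ξ i w := by
      intro g hg w hw
      have : DualConv.lin R D g w = (∑ i, g (x i) • DualConv.lin R D (ξ i)) w := by
        refine LinearMap.eqOn_span (s := c '' {β | ∑ i, β i < 2}) ?_ hw
        rintro _ ⟨β, hβ, rfl⟩
        rw [LinearMap.sum_apply]
        simp only [LinearMap.smul_apply, smul_eq_mul]
        rcases Nat.lt_or_ge (∑ i, β i) 1 with h | h
        · have hβ0 : β = 0 := by
            ext i
            simpa using (Finset.sum_eq_zero_iff.mp (Nat.lt_one_iff.mp h)) i (Finset.mem_univ i)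
          rw [hβ0, hc.zero, mem_groupLikeIdeal.mp hg]
          simp [fun i => mem_groupLikeIdeal.mp (hξ i)]
        · have hβ1 : ∑ i, β i = 0 + 1 := by
            have : ∑ i, β i < 2 := hβ
            omega
          obtain ⟨ζ, j, hζ, rfl⟩ := exists_eq_add_single hβ1
          have hζ0 : ζ = 0 := by
            ext i
            simpa using (Finset.sum_eq_zero_iff.mp hζ) i (Finset.mem_univ i)
          simp [hζ0, hcx, hξx]
      rw [this, LinearMap.sum_apply]
      simp
    -- Factors of an arbitrary element of `I^(m+1)` are traded one by one for the `ξ i`: once the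
    -- remaining `m` factors have acted, `y - z` lands in degree below 2, where `h4` expresses a
    -- functional from `I` through the `ξ i`.
    have h5 : ∀ j l, j + l = m + 1 → ∀ f ∈ augIdeal R D ^ j,
        ∀ β : Fin (Module.finrank R V) → ℕ, ∑ i, β i = l →
          (f * monomialDual ξ β) (y - z) = 0 := by
      intro j
      induction j with
      | zero =>
        intro l hl f _ β hβ
        rw [zero_add] at hl
        have hf : f = f 1 • 1 + (f - f 1 • 1) := by abel
        have h6 := h1 ((f - f 1 • 1) * monomialDual ξ β) (by
          rw [pow_succ' _ (m + 1)]
          exact Ideal.mul_mem_mul (sub_smul_one_mem_augIdeal f)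
            (hl ▸ hβ ▸ monomialDual_mem hξ β))
        rw [hf, add_mul, map_add, LinearMap.add_apply, smul_mul_assoc, one_mul, map_smul,
          LinearMap.smul_apply, h3 β (hβ.trans hl), smul_zero, zero_add, ← counit_dual_smul, h6,
          map_zero]
      | succ j ihj =>
        intro l hl f hf β hβ
        rw [pow_succ] at hf
        induction hf using Submodule.mul_induction_on' with
        | mem_mul_mem a ha g hg =>
          rw [mul_right_comm, mul_comm, dual_mul_apply, h4 g hg _ (h2 _ ?_)]
          · refine Finset.sum_eq_zero fun i _ => ?_
            rw [← dual_mul_apply, mul_comm (ξ i), mul_assoc, ← monomialDual_add_single,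
              ihj (l + 1) (by omega) a ha _ (by simp [Finset.sum_add_distrib, hβ]), mul_zero]
          · have hm : m = j + l := by omega
            rw [hm, pow_add, ← hβ]
            exact Ideal.mul_mem_mul ha (monomialDual_mem hξ β)
        | add a _ b _ ha hb =>
          rw [add_mul, map_add, LinearMap.add_apply, ha, hb, add_zero]
    have h6 : y - z ∈ S := by
      refine ih _ fun f hf => ?_
      have h7 := eq_smul_one_of_augIdeal_smul (y := f • (y - z)) fun g hg => by
        rw [← mul_smul]
        exact h1 _ (by rw [pow_succ' _ (m + 1)]; exact Ideal.mul_mem_mul hg hf)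
      have h8 := h5 (m + 1) 0 rfl f hf 0 (by simp)
      have h9 : monomialDual ξ 0 = 1 := by simp [monomialDual]
      rw [h9, mul_one] at h8
      rw [h7, counit_dual_smul, h8, zero_smul]
    simpa using S.add_mem h6 hzS

end Generation

/-! ### Primary decomposition over artinian quotients -/

section Artinian

/-- In an artinian ring a maximal ideal is a minimal prime, hence an associated prime, that is, an
annihilator. -/
theorem exists_forall_mem_iff_mul_eq_zero {B : Type*} [CommRing B] [IsArtinianRing B]
    (M : Ideal B) [hM : M.IsMaximal] : ∃ b, ∀ a, a ∈ M ↔ a * b = 0 := by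
  have h : M ∈ (Module.annihilator B B).minimalPrimes := by
    refine ⟨⟨hM.isPrime, fun a ha => ?_⟩, fun q hq hle => ?_⟩
    · have := Module.mem_annihilator.mp ha 1
      rw [smul_eq_mul, mul_one] at this
      exact this ▸ M.zero_mem
    · have := hq.1
      exact ((IsArtinianRing.isMaximal_of_isPrime q).eq_of_le hM.ne_top hle).ge
  have h1 := Module.associatedPrimes.minimalPrimes_annihilator_subset_associatedPrimes B B h
  obtain ⟨-, b, hb⟩ := Submodule.isAssociatedPrime_iff.mp h1
  refine ⟨b, fun a => ?_⟩
  rw [hb, Submodule.mem_colon_singleton]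
  simp

theorem exists_prod_maximal_pow_eq_bot (B : Type*) [CommRing B] [IsArtinianRing B]
    [Fintype (MaximalSpectrum B)] : ∃ N : ℕ, ∏ M : MaximalSpectrum B, M.asIdeal ^ N = ⊥ := by
  obtain ⟨N, hN⟩ := IsArtinianRing.isNilpotent_jacobson_bot (R := B)
  refine ⟨N, ?_⟩
  rw [Finset.prod_pow, ← le_bot_iff, ← Ideal.zero_eq_bot, ← hN]
  refine Ideal.pow_right_mono (le_sInf fun I hI => ?_) N
  exact Ideal.prod_le_inf.trans (Finset.inf_le (Finset.mem_univ (⟨I, hI.2⟩ : MaximalSpectrum B)))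

/-- Chinese remainder theorem: the product of the powers is zero in the artinian quotient, so the
intersection of their preimages kills `x`. -/
theorem mem_iSup_torsionBySet_maximal_pow {A V : Type*} [CommRing A] [AddCommGroup V] [Module A V]
    (x : V) [IsArtinianRing (A ⧸ Ideal.torsionOf A V x)] :
    ∃ N : ℕ, x ∈ ⨆ M : MaximalSpectrum (A ⧸ Ideal.torsionOf A V x), Submodule.torsionBySet A V
      ((M.asIdeal.comap (Ideal.Quotient.mk (Ideal.torsionOf A V x)) ^ N : Ideal A) : Set A) := by
  set I := Ideal.torsionOf A V x
  have : Fintype (MaximalSpectrum (A ⧸ I)) := Fintype.ofFinite _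
  obtain ⟨N, hN⟩ := exists_prod_maximal_pow_eq_bot (A ⧸ I)
  refine ⟨N, ?_⟩
  set p : MaximalSpectrum (A ⧸ I) → Ideal A :=
    fun M => M.asIdeal.comap (Ideal.Quotient.mk I) ^ N
  have hp : ((Finset.univ : Finset (MaximalSpectrum (A ⧸ I))) : Set _).Pairwise
      (Function.onFun IsCoprime p) := by
    intro M _ M' _ hne
    refine IsCoprime.pow ?_
    have h1 := M.isMaximal
    have h2 := M'.isMaximal
    have h3 := Ideal.comap_isMaximal_of_surjective (Ideal.Quotient.mk I)
      Ideal.Quotient.mk_surjective (K := M.asIdeal)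
    have h4 := Ideal.comap_isMaximal_of_surjective (Ideal.Quotient.mk I)
      Ideal.Quotient.mk_surjective (K := M'.asIdeal)
    refine Ideal.isCoprime_iff_sup_eq.mpr (h3.coprime_of_ne h4 fun h => hne ?_)
    exact MaximalSpectrum.ext
      (Ideal.comap_injective_of_surjective _ Ideal.Quotient.mk_surjective h)
  have h := Submodule.iSup_torsionBySet_ideal_eq_torsionBySet_iInf (M := V) (p := p)
    (S := Finset.univ) fun M hM M' hM' hne => Ideal.isCoprime_iff_sup_eq.mp (hp hM hM' hne)
  simp only [Finset.mem_univ, iSup_pos] at h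
  rw [h, Submodule.mem_torsionBySet_iff]
  rintro ⟨f, hf⟩
  have h1 : f ∈ ∏ M, p M := by
    rw [Ideal.prod_eq_iInf_of_pairwise_isCoprime hp]
    simpa using hf
  have h2 : Ideal.Quotient.mk I f ∈ (⊥ : Ideal (A ⧸ I)) := by
    rw [← hN]
    have := Ideal.mem_map_of_mem (Ideal.Quotient.mk I) h1
    rw [← Ideal.mapHom_apply, map_prod] at this
    refine (show (_ : Ideal (A ⧸ I)) ≤ _ from
      Finset.prod_le_prod' fun M _ => ?_) this
    rw [map_pow, Ideal.mapHom_apply]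
    exact Ideal.pow_right_mono Ideal.map_comap_le N
  rw [Ideal.mem_bot, Ideal.Quotient.eq_zero_iff_mem] at h2
  exact h2

end Artinian

/-! ### Group-likes from maximal ideals, and generation of `D` -/

section Generation

open Coalgebra

variable {R D : Type*} [Field R] [Ring D] [HopfAlgebra R D] [IsCocomm R D]

theorem IsSubcoalgebra.dual_smul_mem {C : Submodule R D} (hC : IsSubcoalgebra R D C)
    (f : DualConv R D) {x : D} (hx : x ∈ C) : f • x ∈ C := by
  obtain ⟨t, ht⟩ := hC x hx
  rw [dual_smul_def, hit, LinearMap.comp_apply, LinearMap.comp_apply, ← ht]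
  clear ht
  induction t with
  | zero => simp
  | add a b ha hb => simp only [map_add]; exact C.add_mem ha hb
  | tmul a b => simpa using C.smul_mem _ a.2

/-- A linear projection onto `C`, applied to the left leg, fixes `Δ(x)` because functionals on the
right leg separate tensors. Cocommutativity gives the same for the right leg. -/
theorem isSubcoalgebra_of_dual_smul_mem {C : Submodule R D}
    (hC : ∀ (f : DualConv R D), ∀ x ∈ C, f • x ∈ C) : IsSubcoalgebra R D C := by
  intro x hx
  obtain ⟨q, hq⟩ := LinearMap.exists_leftInverse_of_injective C.subtype C.ker_subtype
  set p : D →ₗ[R] D := C.subtype ∘ₗ q with hp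
  have hpC : ∀ y ∈ C, p y = y := fun y hy =>
    congrArg Subtype.val (LinearMap.congr_fun hq ⟨y, hy⟩)
  set t := comul (R := R) x with ht
  have h1 : p.rTensor D t = t := by
    rw [← sub_eq_zero]
    refine eq_zero_of_forall_lTensor fun f => ?_
    have h2 : TensorProduct.rid R D (f.lTensor D (p.rTensor D t)) =
        p (TensorProduct.rid R D (f.lTensor D t)) := by
      generalize t = t
      induction t with
      | zero => simp
      | add a b ha hb => simp only [map_add, ha, hb]
      | tmul a b => simp
    have h3 := hpC _ (hC ((DualConv.lin R D).symm f) x hx)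
    rw [dual_smul_def] at h3
    simp only [hit, LinearEquiv.apply_symm_apply, LinearMap.comp_apply, LinearEquiv.coe_coe] at h3
    rw [map_sub, map_sub, h2, h3, sub_self]
  have h2 : p.lTensor D t = t := by
    have h3 : TensorProduct.comm R D D t = t := Coalgebra.comm_comul R x
    nth_rw 1 [← h3]
    rw [LinearMap.lTensor, TensorProduct.map_comm, ← LinearMap.rTensor, h1, h3]
  refine ⟨TensorProduct.map q q t, ?_⟩
  rw [← LinearMap.comp_apply, ← TensorProduct.map_comp, ← hp]
  rw [← LinearMap.rTensor_comp_lTensor, LinearMap.comp_apply, h2, h1]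

/-- The orbit of `z` is `D*/J` with `J` maximal, so it is a simple subcoalgebra. By pointedness it
is a line, and a suitable multiple of a generator is group-like. -/
theorem exists_groupLikeIdeal_eq (hpointed : IsPointed R D) {J : Ideal (DualConv R D)}
    [hJ : J.IsMaximal] {z : D} (hz : ∀ f, f ∈ J ↔ f • z = 0) :
    ∃ (g : D) (hg : IsGroupLikeElem R g), J = groupLikeIdeal hg := by
  set C : Submodule R D := LinearMap.range (orbitMap (R := R) z) with hC
  have hzC : z ∈ C := ⟨1, by simp⟩
  have hz0 : z ≠ 0 := fun h => hJ.ne_top ((Ideal.eq_top_iff_one J).mpr ((hz 1).mpr (by simp [h])))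
  have hCsub : IsSubcoalgebra R D C := by
    refine isSubcoalgebra_of_dual_smul_mem ?_
    rintro f _ ⟨g, rfl⟩
    exact ⟨f * g, mul_smul f g z⟩
  have hsimple : IsSimpleSubcoalgebra R D C := by
    refine ⟨hCsub, fun h => hz0 ((Submodule.eq_bot_iff C).mp h z hzC), fun C' hC' hle => ?_⟩
    by_cases h : C' = ⊥
    · exact Or.inl h
    refine Or.inr (le_antisymm hle ?_)
    obtain ⟨w, hw, hw0⟩ := Submodule.exists_mem_ne_zero_of_ne_bot h
    obtain ⟨f, rfl⟩ := hle hw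
    obtain ⟨h, i, hi, hhi⟩ := hJ.exists_inv (fun hf => hw0 ((hz f).mp hf))
    have hzC' : z ∈ C' := by
      have h1 := hC'.dual_smul_mem h hw
      have h2 : h • orbitMap (R := R) z f = z := by
        rw [orbitMap_apply, ← mul_smul, ← sub_eq_iff_eq_add.mpr hhi.symm, sub_smul, (hz i).mp hi,
          one_smul, sub_zero]
      rwa [h2] at h1
    rintro _ ⟨f, rfl⟩
    exact hC'.dual_smul_mem f hzC'
  obtain ⟨v, hv0, hv⟩ := finrank_eq_one_iff'.mp (hpointed C hsimple)
  obtain ⟨t, ht⟩ := hCsub v v.2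
  have hspan : ∃ r : R, comul (R := R) (v : D) = r • ((v : D) ⊗ₜ[R] (v : D)) := by
    rw [← ht]
    clear ht
    induction t with
    | zero => exact ⟨0, by simp⟩
    | add a b ha hb =>
      obtain ⟨r, hr⟩ := ha
      obtain ⟨s, hs⟩ := hb
      exact ⟨r + s, by rw [map_add, hr, hs, add_smul]⟩
    | tmul a b =>
      obtain ⟨r, rfl⟩ := hv a
      obtain ⟨s, rfl⟩ := hv b
      exact ⟨r * s, by simp [TensorProduct.smul_tmul', TensorProduct.tmul_smul, mul_smul,
        smul_comm r s]⟩
  obtain ⟨r, hr⟩ := hspan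
  have hv0' : (v : D) ≠ 0 := fun h => hv0 (Subtype.ext h)
  have hrv : r * counit (R := R) (v : D) = 1 := by
    have h := congrArg (TensorProduct.rid R D) (Coalgebra.lTensor_counit_comul (R := R) (v : D))
    rw [hr] at h
    simp only [map_smul, LinearMap.lTensor_tmul, TensorProduct.rid_tmul, one_smul, smul_smul] at h
    exact smul_left_injective R hv0' (by simpa using h)
  have hg : IsGroupLikeElem R (r • (v : D)) := by
    refine ⟨by simpa using hrv, ?_⟩
    rw [map_smul, hr, TensorProduct.smul_tmul', TensorProduct.tmul_smul]
  refine ⟨_, hg, ?_⟩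
  ext f
  obtain ⟨s, hs⟩ := hv ⟨z, hzC⟩
  have hs' : s • (v : D) = z := congrArg Subtype.val hs
  have hr0 : r ≠ 0 := fun h => by simp [h] at hrv
  have hs0 : s ≠ 0 := fun h => hz0 (by rw [← hs', h, zero_smul])
  have hzg : z = (s * r⁻¹) • r • (v : D) := by
    rw [smul_smul, mul_assoc, inv_mul_cancel₀ hr0, mul_one, hs']
  rw [hz, mem_groupLikeIdeal, hzg, dual_smul_smul, dual_smul_groupLike f hg, smul_eq_zero,
    smul_eq_zero]
  simp only [mul_eq_zero, hs0, inv_eq_zero, hr0, hg.ne_zero, or_false, false_or]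

theorem translate_pow_smul {g h : D} (hg : IsGroupLikeElem R g) (hh : IsGroupLikeElem R h)
    (hgh : h * g = 1) (N : ℕ) :
    ∀ y : D, (∀ f ∈ groupLikeIdeal hg ^ N, f • y = 0) →
      ∀ f ∈ augIdeal R D ^ N, f • (h * y) = 0 := by
  induction N with
  | zero =>
    intro y hy f _
    have : y = 0 := by simpa using hy 1 (by simp)
    simp [this]
  | succ N ih =>
    intro y hy f hf
    rw [pow_succ] at hf
    induction hf using Submodule.mul_induction_on' with
    | mem_mul_mem a ha b hb =>
      rw [mul_smul, dual_smul_groupLike_mul b hh]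
      refine ih _ (fun c hc => ?_) a ha
      rw [← mul_smul]
      refine hy _ ?_
      rw [pow_succ]
      refine Ideal.mul_mem_mul hc ?_
      rw [mem_groupLikeIdeal, DualConv.translate_apply, hgh]
      exact hb
    | add a _ b _ ha hb => rw [add_smul, ha, hb, add_zero]

/-- A pointed cocommutative Hopf algebra of Birkhoff-Witt type is generated by its group-like
elements and its divided power sequences. -/
theorem subalgebra_eq_top (hpointed : IsPointed R D) (hBW : IsBirkhoffWitt R D)
    {S : Subalgebra R D} (hG : ∀ g : D, IsGroupLikeElem R g → g ∈ S)
    (hS : ∀ d : ℕ → D, IsDividedPowerSeq R D d → ∀ n, d n ∈ S) : S = ⊤ := by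
  refine Algebra.eq_top_iff.mpr fun x => ?_
  set I := Ideal.torsionOf (DualConv R D) D x with hI
  -- This quotient is the orbit of `x`, which is finite-dimensional.
  have hfin : Module.Finite R (DualConv R D ⧸ I) := by
    let e := (Ideal.quotTorsionOfEquivSpanSingleton (DualConv R D) D x).restrictScalars R
    let F : (DualConv R D ⧸ I) →ₗ[R] D :=
      ((Submodule.span (DualConv R D) {x}).subtype.restrictScalars R) ∘ₗ e.toLinearMap
    have hF : ∀ u, F u ∈ LinearMap.range (orbitMap (R := R) x) := fun u => by
      obtain ⟨f, hf⟩ := Submodule.mem_span_singleton.mp (e u).2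
      exact ⟨f, hf⟩
    refine Module.Finite.of_injective (F.codRestrict _ hF) ?_
    intro u v huv
    have h := Subtype.ext_iff.mp huv
    exact e.injective (Subtype.ext h)
  have : IsArtinianRing (DualConv R D ⧸ I) := IsArtinianRing.of_finite R _
  obtain ⟨N, hN⟩ := mem_iSup_torsionBySet_maximal_pow (A := DualConv R D) x
  refine Submodule.iSup_induction _ (motive := fun y => y ∈ S) hN (fun M y hy => ?_) S.zero_mem
    fun _ _ => S.add_mem
  have hM := M.isMaximal
  have hJ := Ideal.comap_isMaximal_of_surjective (Ideal.Quotient.mk I)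
    Ideal.Quotient.mk_surjective (K := M.asIdeal)
  obtain ⟨b, hb⟩ := exists_forall_mem_iff_mul_eq_zero M.asIdeal
  obtain ⟨f, rfl⟩ := Ideal.Quotient.mk_surjective b
  obtain ⟨g, hg, hJg⟩ := exists_groupLikeIdeal_eq hpointed
    (J := M.asIdeal.comap (Ideal.Quotient.mk I)) (z := f • x) fun h => by
      rw [Ideal.mem_comap, hb, ← map_mul, Ideal.Quotient.eq_zero_iff_mem, hI,
        Ideal.mem_torsionOf_iff, mul_smul]
  rw [hJg] at hy
  have h1 := translate_pow_smul hg hg.antipode hg.antipode_mul_cancel N y fun f hf =>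
    (Submodule.mem_torsionBySet_iff _ _).mp hy ⟨f, hf⟩
  -- The cited lemma wants an exponent of the form `m + 1`; enlarging `N` by one avoids treating `N
  -- = 0` apart.
  have h2 := mem_of_augIdeal_pow_smul hBW hS N _ fun f hf =>
    h1 f (Ideal.pow_le_pow_right N.le_succ hf)
  have h3 := S.mul_mem (hG g hg) h2
  rwa [← mul_assoc, hg.mul_antipode_cancel, one_mul] at h3

end Generation

/-! ### Nilpotents and idempotents of AS module algebras -/

section ModuleAlgebra

open Coalgebra

variable {R D A : Type*} [Field R] [Ring D] [HopfAlgebra R D] [CommRing A] [Algebra R A]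
  [Module D A] [IsScalarTower R D A]

variable (D) in
/-- The subalgebra of `D` stabilizing a subspace of `A`. -/
def stabilizer (X : Submodule R A) : Subalgebra R D where
  carrier := {d | ∀ x ∈ X, d • x ∈ X}
  mul_mem' {c d} hc hd x hx := by
    rw [mul_smul]
    exact hc _ (hd x hx)
  add_mem' {c d} hc hd x hx := by
    rw [add_smul]
    exact X.add_mem (hc x hx) (hd x hx)
  algebraMap_mem' r x hx := by
    rw [algebraMap_smul]
    exact X.smul_mem r hx

theorem smul_mem_of_generators [IsCocomm R D] (hpointed : IsPointed R D)
    (hBW : IsBirkhoffWitt R D) (X : Submodule R A)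
    (hG : ∀ g : D, IsGroupLikeElem R g → ∀ x ∈ X, g • x ∈ X)
    (hS : ∀ d : ℕ → D, IsDividedPowerSeq R D d → ∀ n, ∀ x ∈ X, d n • x ∈ X) (d : D) {x : A}
    (hx : x ∈ X) : d • x ∈ X := by
  have h : stabilizer D X = ⊤ := subalgebra_eq_top hpointed hBW hG hS
  exact (h ▸ Algebra.mem_top : d ∈ stabilizer D X) x hx

variable [IsModuleAlgebra R D A]

theorem IsGroupLikeElem.smul_mul {g : D} (hg : IsGroupLikeElem R g) (a b : A) :
    g • (a * b) = (g • a) * (g • b) := by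
  rw [IsModuleAlgebra.smul_mul (R := R), hg.comul_eq_tmul_self]
  rfl

theorem IsGroupLikeElem.smul_one {g : D} (hg : IsGroupLikeElem R g) : g • (1 : A) = 1 := by
  rw [IsModuleAlgebra.smul_one (R := R), hg.counit_eq_one, map_one]

/-- The generating function `a ↦ ∑ dₙ(a) tⁿ` of a divided power sequence. -/
noncomputable def IsDividedPowerSeq.toPowerSeries {d : ℕ → D} (hd : IsDividedPowerSeq R D d) :
    A →ₙ+* PowerSeries A where
  toFun a := PowerSeries.mk fun n => d n • a
  map_mul' a b := by
    ext n
    rw [PowerSeries.coeff_mk, IsModuleAlgebra.smul_mul (R := R), hd.2.2, PowerSeries.coeff_mul,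
      Finset.Nat.sum_antidiagonal_eq_sum_range_succ_mk]
    simp [act]
  map_zero' := by
    ext n
    simp
  map_add' a b := by
    ext n
    simp

theorem IsDividedPowerSeq.coeff_toPowerSeries {d : ℕ → D} (hd : IsDividedPowerSeq R D d) (n : ℕ)
    (a : A) : (hd.toPowerSeries a).coeff n = d n • a :=
  PowerSeries.coeff_mk n fun n => d n • a

-- Modulo a prime the power series ring is a domain, so the series vanishes modulo every prime.
omit [Field R] [Algebra R A] in
theorem isNilpotent_coeff {f : PowerSeries A} (hf : IsNilpotent f) (n : ℕ) :
    IsNilpotent (f.coeff n) := by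
  rw [← mem_nilradical, nilradical_eq_sInf, Ideal.mem_sInf]
  intro P (hP : P.IsPrime)
  have h : PowerSeries.map (Ideal.Quotient.mk P) f = 0 :=
    (hf.map (PowerSeries.map (Ideal.Quotient.mk P))).eq_zero
  have h1 := congrArg (PowerSeries.coeff n) h
  rwa [PowerSeries.coeff_map, map_zero, Ideal.Quotient.eq_zero_iff_mem] at h1

-- If `e` is the constant term, the difference `u = f - e` of two idempotents satisfies `u³ = u`,
-- while `1 - u²` is a unit because `u` has no constant term. Hence `u = 0`.
omit [Field R] [Algebra R A] in
theorem coeff_of_idempotent {f : PowerSeries A} (hf : f * f = f) {n : ℕ} (hn : n ≠ 0) :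
    f.coeff n = 0 := by
  set e := PowerSeries.C (PowerSeries.constantCoeff f) with he
  have hee : e * e = e := by rw [he, ← map_mul, ← map_mul, hf]
  have h1 : (1 - (f - e) * (f - e)) * (f - e) = 0 := by
    linear_combination (-f - 1 + 3 * e) * hf + (-3 * f + e + 1) * hee
  have h2 : IsUnit (1 - (f - e) * (f - e)) := by
    rw [PowerSeries.isUnit_iff_constantCoeff]
    simp [he]
  have h3 : f = e := sub_eq_zero.mp ((h2.mul_right_eq_zero).mp h1)
  rw [h3, he, PowerSeries.coeff_C, if_neg hn]

theorem nilradical_stable [IsCocomm R D] (hpointed : IsPointed R D) (hBW : IsBirkhoffWitt R D)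
    (d : D) {x : A} (hx : x ∈ nilradical A) : d • x ∈ nilradical A := by
  refine smul_mem_of_generators hpointed hBW ((nilradical A).restrictScalars R) ?_ ?_ d hx
  · rintro g hg x hx
    obtain ⟨n, hn⟩ := mem_nilradical.mp hx
    have key : ∀ k, g • x ^ k = (g • x) ^ k := fun k => by
      induction k with
      | zero => simpa using IsGroupLikeElem.smul_one hg
      | succ k ih => rw [pow_succ, IsGroupLikeElem.smul_mul hg, ih, pow_succ]
    exact mem_nilradical.mpr ⟨n, by rw [← key, hn, smul_zero]⟩
  · rintro d hd n x hx
    obtain ⟨k, hk⟩ := mem_nilradical.mp hx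
    have h : IsNilpotent (hd.toPowerSeries x) := by
      refine ⟨k + 1, ?_⟩
      -- The generating function is only a non-unital homomorphism, so exponents start at one.
      have key : ∀ k, hd.toPowerSeries (x ^ (k + 1)) = hd.toPowerSeries x ^ (k + 1) := fun k => by
        induction k with
        | zero => simp
        | succ k ih => rw [pow_succ, map_mul, ih, ← pow_succ]
      rw [← key, pow_succ, hk, zero_mul, map_zero]
    have h1 := isNilpotent_coeff h n
    rw [hd.coeff_toPowerSeries] at h1
    exact mem_nilradical.mpr h1

theorem IsAS.isReduced [IsCocomm R D] (hpointed : IsPointed R D) (hBW : IsBirkhoffWitt R D)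
    (hA : IsAS D A) : IsReduced A := by
  have := hA.nontrivial
  rw [← nilradical_eq_bot_iff]
  refine (hA.simple (nilradical A) fun d x hx => nilradical_stable hpointed hBW d hx).resolve_right
    fun h => ?_
  have h1 : (1 : A) ∈ nilradical A := h ▸ Submodule.mem_top
  exact not_isNilpotent_one h1

theorem smul_mul_mem (R : Type*) {D A : Type*} [Field R] [Ring D] [HopfAlgebra R D]
    [CommRing A] [Algebra R A] [Module D A] [IsScalarTower R D A] [IsModuleAlgebra R D A]
    {I : Ideal A} {b : A} (hb : ∀ d : D, d • b ∈ I) (d : D) (a : A) :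
    d • (a * b) ∈ I := by
  rw [IsModuleAlgebra.smul_mul (R := R)]
  generalize comul (R := R) d = t
  induction t with
  | zero => simp
  | add x y hx hy => simp only [map_add]; exact I.add_mem hx hy
  | tmul x y => exact I.mul_mem_left _ (hb y)

theorem span_stable (R : Type*) {D A : Type*} [Field R] [Ring D] [HopfAlgebra R D]
    [CommRing A] [Algebra R A] [Module D A] [IsScalarTower R D A] [IsModuleAlgebra R D A]
    {X : Set A} (hX : ∀ x ∈ X, ∀ d : D, d • x ∈ Ideal.span X) {z : A}
    (hz : z ∈ Ideal.span X) : ∀ d : D, d • z ∈ Ideal.span X := by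
  induction hz using Submodule.span_induction with
  | mem x hx => exact hX x hx
  | zero => simp
  | add x y _ _ hx hy => exact fun d => by rw [smul_add]; exact Ideal.add_mem _ (hx d) (hy d)
  | smul a x _ hx => exact fun d => smul_mul_mem R hx d a

/-- Idempotents of a power series ring are constant, so divided powers of positive index kill every
idempotent. The span of the group-like translates of `e` is therefore `D`-stable, and simplicity
applies to the ideal it generates. -/
theorem span_groupLike_smul_eq_top [IsCocomm R D] (hpointed : IsPointed R D)
    (hBW : IsBirkhoffWitt R D) (hA : IsAS D A) {e : A} (he : e * e = e) (he0 : e ≠ 0) :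
    Ideal.span {x | ∃ g : D, IsGroupLikeElem R g ∧ g • e = x} = ⊤ := by
  set X : Set A := {x | ∃ g : D, IsGroupLikeElem R g ∧ g • e = x}
  have heX : e ∈ X := ⟨1, .one, one_smul _ _⟩
  have hXX : ∀ g : D, IsGroupLikeElem R g → ∀ x ∈ X, g • x ∈ X := by
    rintro g hg _ ⟨h, hh, rfl⟩
    exact ⟨g * h, hg.mul hh, mul_smul _ _ _⟩
  have hstab : ∀ d : D, ∀ x ∈ Submodule.span R X, d • x ∈ Submodule.span R X := by
    refine fun d x hx => smul_mem_of_generators hpointed hBW _ ?_ ?_ d hx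
    · intro g hg x hx
      induction hx using Submodule.span_induction with
      | mem x hx => exact Submodule.subset_span (hXX g hg x hx)
      | zero => simp
      | add x y _ _ hx hy => rw [smul_add]; exact Submodule.add_mem _ hx hy
      | smul r x _ hx => rw [smul_algebra_smul_comm]; exact Submodule.smul_mem _ _ hx
    · intro d hd n x hx
      induction hx using Submodule.span_induction with
      | mem x hx =>
        by_cases hn : n = 0
        · rw [hn, hd.1, one_smul]
          exact Submodule.subset_span hx
        · obtain ⟨g, hg, rfl⟩ := hx
          have h1 : (g • e) * (g • e) = g • e := by rw [← IsGroupLikeElem.smul_mul hg, he]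
          have h2 := coeff_of_idempotent (f := hd.toPowerSeries (g • e))
            (by rw [← map_mul, h1]) hn
          rw [hd.coeff_toPowerSeries] at h2
          rw [h2]
          exact Submodule.zero_mem _
      | zero => simp
      | add x y _ _ hx hy => rw [smul_add]; exact Submodule.add_mem _ hx hy
      | smul r x _ hx => rw [smul_algebra_smul_comm]; exact Submodule.smul_mem _ _ hx
  have hle : Submodule.span R X ≤ (Ideal.span X).restrictScalars R :=
    Submodule.span_le.mpr Ideal.subset_span
  refine (hA.simple (Ideal.span X) fun d x hx => span_stable R (fun x hx d => hle
    (hstab d x (Submodule.subset_span hx))) hx d).resolve_left fun h => he0 ?_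
  rw [← Ideal.mem_bot, ← h]
  exact Ideal.subset_span heX

end ModuleAlgebra

/-! ### Coideals and row reduction over `M_J` -/

section Bimodule

variable {K L : Type*} [CommRing K] [CommRing L] [Algebra K L]

theorem leftAct_eq_mul (a : L) (x : L ⊗[K] L) : leftAct a x = (a ⊗ₜ[K] 1) * x := by
  induction x with
  | zero => simp
  | add x y hx hy => simp [mul_add, hx, hy]
  | tmul x y => simp [leftAct]

theorem rightAct_eq_mul (a : L) (x : L ⊗[K] L) : rightAct a x = (1 ⊗ₜ[K] a) * x :=
  (smul_toRight K L a x).symm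

/-- A sub-bimodule of `L ⊗_K L`, as an ideal of the algebra `L ⊗_K L`. -/
def SubBimodule.toIdeal (J : SubBimodule K L) : Ideal (L ⊗[K] L) where
  carrier := J.toAddSubgroup
  add_mem' := J.toAddSubgroup.add_mem
  zero_mem' := J.toAddSubgroup.zero_mem
  smul_mem' t x hx := by
    induction t with
    | zero => rw [zero_smul]; exact J.toAddSubgroup.zero_mem
    | add s t hs ht => rw [add_smul]; exact J.toAddSubgroup.add_mem hs ht
    | tmul a b =>
      have h := J.left_mem' a _ (J.right_mem' b x hx)
      rw [leftAct_eq_mul, rightAct_eq_mul, ← mul_assoc, Algebra.TensorProduct.tmul_mul_tmul,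
        mul_one, one_mul] at h
      exact h

theorem SubBimodule.mem_toIdeal {J : SubBimodule K L} {x : L ⊗[K] L} :
    x ∈ J.toIdeal ↔ x ∈ J.toAddSubgroup := Iff.rfl

theorem SubBimodule.mem_toSubalgebra {J : SubBimodule K L} {a : L} :
    a ∈ J.toSubalgebra ↔ a ⊗ₜ[K] (1 : L) - (1 : L) ⊗ₜ[K] a ∈ J.toIdeal :=
  J.quotAct_eq_iff a

theorem SubBimodule.mem_toSubalgebra_iff {J : SubBimodule K L} {a : L} :
    a ∈ J.toSubalgebra ↔ Ideal.Quotient.mk J.toIdeal (a ⊗ₜ[K] (1 : L)) =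
      Ideal.Quotient.mk J.toIdeal ((1 : L) ⊗ₜ[K] a) := by
  rw [Ideal.Quotient.mk_eq_mk_iff_sub_mem, mem_toSubalgebra]

/-- Elements of `M_J` can be moved across the tensor sign modulo `J`. -/
theorem SubBimodule.mk_mul_tmul {J : SubBimodule K L} {m : L} (hm : m ∈ J.toSubalgebra) (a b : L) :
    Ideal.Quotient.mk J.toIdeal ((m * a) ⊗ₜ[K] b) =
      Ideal.Quotient.mk J.toIdeal (a ⊗ₜ[K] (m * b)) := by
  have h1 : (m * a) ⊗ₜ[K] b = (m ⊗ₜ[K] 1) * (a ⊗ₜ[K] b) := by simp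
  have h2 : a ⊗ₜ[K] (m * b) = (1 ⊗ₜ[K] m) * (a ⊗ₜ[K] b) := by simp
  rw [h1, h2, map_mul, map_mul, mem_toSubalgebra_iff.mp hm]

/-- If `v` is a relation `∑ vᵢ ⊗ bᵢ ∈ J` for a coideal `J` and `μ` is orthogonal to all such
relations, then `∑ vᵢ ⊗ μᵢ ∈ J`. -/
theorem SubBimodule.IsCoideal.sum_tmul_mem [IsSemisimpleRing L] {J : SubBimodule K L}
    (hJ : J.IsCoideal) {n : ℕ} {b v μ : Fin n → L}
    (hv : ∑ i, v i ⊗ₜ[K] b i ∈ J.toIdeal)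
    (hμ : ∀ w : Fin n → L, ∑ i, w i ⊗ₜ[K] b i ∈ J.toIdeal → ∑ i, w i * μ i = 0) :
    ∑ i, v i ⊗ₜ[K] μ i ∈ J.toIdeal := by
  let I : Submodule L (L ⊗[K] L) := J.toIdeal.restrictScalars L
  let φ : (Fin n → L) →ₗ[L] (L ⊗[K] L) ⧸ I :=
    Fintype.linearCombination L fun i => I.mkQ (1 ⊗ₜ[K] b i)
  let lam : (Fin n → L) →ₗ[L] L := Fintype.linearCombination L μ
  have hφ : ∀ w, φ w = I.mkQ (∑ i, w i ⊗ₜ[K] b i) := fun w => by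
    simp only [φ, Fintype.linearCombination_apply, map_sum, ← map_smul, TensorProduct.smul_tmul',
      smul_eq_mul, mul_one]
  have hlam : LinearMap.ker φ ≤ LinearMap.ker lam := fun w hw => by
    rw [LinearMap.mem_ker, hφ, Submodule.mkQ_apply, Submodule.Quotient.mk_eq_zero] at hw
    simpa [lam, Fintype.linearCombination_apply] using hμ w hw
  -- Orthogonality makes `μ` a functional on the image of `φ`; semisimplicity extends it to all of
  -- `C/J`. So `ψ` kills `J` and sends `1 ⊗ bᵢ` to `μᵢ`.
  obtain ⟨h, hh⟩ := IsSemisimpleModule.extension_property ((LinearMap.ker φ).liftQ φ le_rfl)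
    (LinearMap.ker_eq_bot.mp (Submodule.ker_liftQ_eq_bot _ _ _ le_rfl))
    ((LinearMap.ker φ).liftQ lam hlam)
  let ψ : L ⊗[K] L →ₗ[L] L := h ∘ₗ I.mkQ
  have hψJ : ∀ j ∈ J.toIdeal, ψ j = 0 := fun j hj => by
    have : I.mkQ j = 0 := by
      rw [Submodule.mkQ_apply, Submodule.Quotient.mk_eq_zero]
      exact hj
    simp only [ψ, LinearMap.comp_apply, this, map_zero]
  have hψb : ∀ i, ψ (1 ⊗ₜ[K] b i) = μ i := fun i => by
    have h1 : h (φ (Pi.single i 1)) = lam (Pi.single i 1) :=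
      LinearMap.congr_fun hh ((LinearMap.ker φ).mkQ (Pi.single i 1))
    have h2 : φ (Pi.single i 1) = I.mkQ (1 ⊗ₜ[K] b i) := by
      simp [φ, Fintype.linearCombination_apply_single]
    have h3 : lam (Pi.single i 1) = μ i := by
      simp [lam, Fintype.linearCombination_apply_single]
    exact (h2 ▸ h1).trans h3
  -- This is `id ⊗ ψ` modulo `J`. It kills both `J ⊗ C` and `C ⊗ J`, hence `Δ(J)`.
  let Θ : CoringTensor K L →+ (L ⊗[K] L) ⧸ J.toIdeal := TensorProduct.liftAddHom
    (AddMonoidHom.mk' (fun t : RightTensor K L =>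
      AddMonoidHom.mk' (fun c : L ⊗[K] L =>
        Ideal.Quotient.mk J.toIdeal ((1 ⊗ₜ[K] ψ c) * (show L ⊗[K] L from t)))
      (fun c c' => by rw [map_add, TensorProduct.tmul_add, add_mul, map_add]))
      (fun t t' => by
        ext c
        change Ideal.Quotient.mk J.toIdeal ((1 ⊗ₜ[K] ψ c) *
          ((show L ⊗[K] L from t) + (show L ⊗[K] L from t'))) = _
        rw [mul_add, map_add]
        rfl))
    (fun r t c => by
      change Ideal.Quotient.mk J.toIdeal ((1 ⊗ₜ[K] ψ c) * ((1 ⊗ₜ[K] r) * (show L ⊗[K] L from t))) =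
        Ideal.Quotient.mk J.toIdeal ((1 ⊗ₜ[K] ψ (r • c)) * (show L ⊗[K] L from t))
      rw [← mul_assoc, Algebra.TensorProduct.tmul_mul_tmul, mul_one, map_smul, smul_eq_mul,
        mul_comm r])
  have hΘ : ∀ (t c : L ⊗[K] L), Θ (toRight t ⊗ₜ[L] c) =
      Ideal.Quotient.mk J.toIdeal ((1 ⊗ₜ[K] ψ c) * t) := fun t c => rfl
  have hle : AddSubgroup.closure
      {t : CoringTensor K L | ∃ j ∈ J.toAddSubgroup, ∃ c : L ⊗[K] L,
        t = toRight j ⊗ₜ[L] c ∨ t = toRight c ⊗ₜ[L] j} ≤ Θ.ker := by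
    rw [AddSubgroup.closure_le]
    rintro _ ⟨j, hj, c, rfl | rfl⟩
    · change Θ _ = 0
      rw [hΘ, Ideal.Quotient.eq_zero_iff_mem]
      exact J.toIdeal.mul_mem_left _ hj
    · change Θ _ = 0
      rw [hΘ, hψJ j hj, TensorProduct.tmul_zero, zero_mul, map_zero]
  have h1 : Θ (coringComul K L (∑ i, v i ⊗ₜ[K] b i)) = 0 := hle (hJ.2 _ hv)
  rw [map_sum, map_sum] at h1
  simp only [coringComul_tmul, hΘ, hψb, Algebra.TensorProduct.tmul_mul_tmul, one_mul, mul_one,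
    ← map_sum] at h1
  exact Ideal.Quotient.eq_zero_iff_mem.mp h1

/-- A submodule of `Lⁿ` satisfying the orthogonality property of subcomodules is the image of an
idempotent matrix with entries in `M_J`. -/
theorem SubBimodule.exists_matrix [IsSemisimpleRing L] {J : SubBimodule K L}
    (hsymm : ∀ e : L, e * e = e → e ⊗ₜ[K] (1 - e) ∈ J.toIdeal → (1 - e) ⊗ₜ[K] e ∈ J.toIdeal) :
    ∀ (n : ℕ) (V : Submodule L (Fin n → L)),
      (∀ v ∈ V, ∀ μ : Fin n → L, (∀ w ∈ V, ∑ i, w i * μ i = 0) →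
        ∑ i, v i ⊗ₜ[K] μ i ∈ J.toIdeal) →
      ∃ P : Fin n → Fin n → L, (∀ i j, P i j ∈ J.toSubalgebra) ∧ (∀ i, P i ∈ V) ∧
        ∀ v ∈ V, ∑ i, v i • P i = v
  | 0, V, _ => ⟨fun i => i.elim0, fun i => i.elim0, fun i => i.elim0,
      fun v _ => Subsingleton.elim _ _⟩
  | n + 1, V, hV => by
    obtain ⟨e, he, hVe⟩ := IsSemisimpleRing.ideal_eq_span_idempotent
      (V.map (LinearMap.proj (R := L) (φ := fun _ : Fin (n + 1) => L) 0))
    have hv0 : ∀ v ∈ V, v 0 * e = v 0 := fun v hv => by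
      have h1 : v 0 ∈ Ideal.span {e} := hVe ▸ ⟨v, hv, rfl⟩
      obtain ⟨c, hc⟩ := Ideal.mem_span_singleton'.mp h1
      rw [← hc, mul_assoc, he.eq]
    obtain ⟨w₀, hw₀, hw₀e, hew₀⟩ : ∃ w ∈ V, w 0 = e ∧ e • w = w := by
      have h1 : e ∈ Ideal.span {e} := Ideal.mem_span_singleton_self e
      rw [← hVe] at h1
      obtain ⟨w, hw, hwe⟩ := h1
      refine ⟨e • w, V.smul_mem e hw, ?_, by rw [smul_smul, he.eq]⟩
      change e * w 0 = e
      rw [show w 0 = e from hwe, he.eq]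
    -- The pivot: `(1 - e, 0, …, 0)` is orthogonal to `V`, which gives `e ⊗ (1 - e) ∈ J`, and
    -- `hsymm` supplies the mirror relation.
    have heM : e ∈ J.toSubalgebra := by
      have h1 : e ⊗ₜ[K] (1 - e) ∈ J.toIdeal := by
        have h2 := hV w₀ hw₀ (Pi.single 0 (1 - e)) fun v hv => by
          simp [Fin.sum_univ_succ, mul_sub, hv0 v hv]
        simpa [Fin.sum_univ_succ, hw₀e] using h2
      rw [mem_toSubalgebra]
      have h2 := J.toIdeal.sub_mem h1 (hsymm e he.eq h1)
      rw [TensorProduct.tmul_sub, TensorProduct.sub_tmul] at h2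
      simpa using h2
    let cons₀ : (Fin n → L) →ₗ[L] (Fin (n + 1) → L) :=
      { toFun u := Fin.cons 0 u
        map_add' u u' := by
          ext i
          refine Fin.cases ?_ (fun i => ?_) i <;> simp
        map_smul' c u := by
          ext i
          refine Fin.cases ?_ (fun i => ?_) i <;> simp }
    have hcons : ∀ u, cons₀ u = Fin.cons 0 u := fun u => rfl
    have htail : ∀ v ∈ V, v 0 = 0 → Fin.tail v ∈ V.comap cons₀ := fun v hv h0 => by
      rw [Submodule.mem_comap, hcons, ← h0, Fin.cons_self_tail]
      exact hv
    obtain ⟨P, hPM, hPV, hP⟩ := exists_matrix hsymm n (V.comap cons₀) (by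
      intro u hu μ hμ
      -- The first entry is chosen orthogonal to `w₀`; every `v ∈ V` differs from `v 0 • w₀` by a
      -- vector with zero first entry.
      have h1 := hV _ hu (Fin.cons (-∑ i, w₀ i.succ * μ i) μ) fun v hv => by
        have h2 := hμ _ (htail (v - v 0 • w₀) (V.sub_mem hv (V.smul_mem _ hw₀))
          (by simp [hw₀e, hv0 v hv]))
        simp only [Fin.tail, Pi.sub_apply, Pi.smul_apply, smul_eq_mul, sub_mul,
          Finset.sum_sub_distrib, mul_assoc, ← Finset.mul_sum] at h2
        rw [Fin.sum_univ_succ]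
        simp only [Fin.cons_zero, Fin.cons_succ]
        linear_combination h2
      rw [Fin.sum_univ_succ] at h1
      simpa [hcons] using h1)
    let π : (Fin n → L) →ₗ[L] (Fin n → L) := Fintype.linearCombination L P
    have hπ : ∀ u, π u = ∑ i, u i • P i := fun u => Fintype.linearCombination_apply L P u
    have hπV : ∀ u, π u ∈ V.comap cons₀ := fun u => by
      rw [hπ]
      exact Submodule.sum_mem _ fun i _ => Submodule.smul_mem _ _ (hPV i)
    have hππ : ∀ u ∈ V.comap cons₀, π u = u := fun u hu => by rw [hπ, hP u hu]
    -- The reduced pivot row: its tail is cleared against the rows already found.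
    set w : Fin (n + 1) → L := w₀ - cons₀ (π (Fin.tail w₀)) with hw
    have hwV : w ∈ V := V.sub_mem hw₀ (hπV _)
    have hwe : w 0 = e := by simp [hw, hcons, hw₀e]
    have htw : Fin.tail w = Fin.tail w₀ - π (Fin.tail w₀) := by
      ext i
      simp [hw, hcons, Fin.tail]
    have hπw : π (Fin.tail w) = 0 := by
      rw [htw, map_sub, hππ _ (hπV _), sub_self]
    have hew : e • w = w := by
      have h1 : e • Fin.tail w₀ = Fin.tail w₀ := by
        ext i
        exact congrFun hew₀ i.succ
      rw [hw, smul_sub, hew₀, ← map_smul, ← map_smul, h1]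
    have hdecomp : ∀ v ∈ V, Fin.tail v = π (Fin.tail v) + v 0 • Fin.tail w := fun v hv => by
      have h1 := hππ _ (htail (v - v 0 • w) (V.sub_mem hv (V.smul_mem _ hwV))
          (by simp [hwe, hv0 v hv]))
      have h2 : Fin.tail (v - v 0 • w) = Fin.tail v - v 0 • Fin.tail w := rfl
      rw [h2, map_sub, map_smul, hπw, smul_zero, sub_zero] at h1
      rw [h1, sub_add_cancel]
    have hwM : ∀ i : Fin n, w i.succ ∈ J.toSubalgebra := fun i => by
      -- Orthogonality to this vector is the `i`-th coordinate of `hdecomp`. Applied to `w`, it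
      -- gives `wᵢ ⊗ 1 ≡ e ⊗ wᵢ`: the terms with `P j i ∈ M_J` move to the left and cancel since `π`
      -- kills the tail of `w`.
      have h1 := hV w hwV (Fin.cons (-w i.succ) fun j => (Pi.single i 1 : Fin n → L) j - P j i)
        fun v hv => by
          have h2 := congrFun (hdecomp v hv) i
          rw [hπ] at h2
          simp only [Fin.tail, Pi.add_apply, Finset.sum_apply, Pi.smul_apply, smul_eq_mul] at h2
          rw [Fin.sum_univ_succ]
          simp only [Fin.cons_zero, Fin.cons_succ, mul_sub, Finset.sum_sub_distrib]
          have h3 : ∑ j : Fin n, v j.succ * (Pi.single i 1 : Fin n → L) j = v i.succ := by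
            simp [Pi.single_apply]
          rw [h3]
          linear_combination h2
      rw [Fin.sum_univ_succ] at h1
      simp only [Fin.cons_zero, Fin.cons_succ, TensorProduct.tmul_sub,
        Finset.sum_sub_distrib] at h1
      have h3 : ∑ j : Fin n, w j.succ ⊗ₜ[K] (Pi.single i 1 : Fin n → L) j =
          w i.succ ⊗ₜ[K] (1 : L) := by
        rw [Finset.sum_eq_single i]
        · simp
        · intro j _ hj
          simp [hj]
        · simp
      have h4 : Ideal.Quotient.mk J.toIdeal (∑ j : Fin n, w j.succ ⊗ₜ[K] P j i) = 0 := by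
        have h5 : ∀ j : Fin n, Ideal.Quotient.mk J.toIdeal (w j.succ ⊗ₜ[K] P j i) =
            Ideal.Quotient.mk J.toIdeal ((w j.succ * P j i) ⊗ₜ[K] 1) := fun j => by
          rw [mul_comm, mk_mul_tmul (hPM j i), mul_one]
        have h6 := congrFun hπw i
        rw [hπ] at h6
        simp only [Fin.tail, Finset.sum_apply, Pi.smul_apply, smul_eq_mul, Pi.zero_apply] at h6
        rw [map_sum, Finset.sum_congr rfl fun j _ => h5 j, ← map_sum, ← TensorProduct.sum_tmul,
          h6, TensorProduct.zero_tmul, map_zero]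
      rw [← Ideal.Quotient.eq_zero_iff_mem, map_add, map_sub, h3, h4, sub_zero, hwe,
        TensorProduct.tmul_neg, map_neg, neg_add_eq_zero] at h1
      rw [mem_toSubalgebra_iff, ← h1]
      have h5 := mk_mul_tmul heM 1 (w i.succ)
      rw [mul_one] at h5
      rw [h5]
      congr 2
      exact congrFun hew i.succ
    refine ⟨Fin.cons w fun i => cons₀ (P i), fun i j => ?_, fun i => ?_, fun v hv => ?_⟩
    · refine Fin.cases ?_ (fun i => ?_) i <;> refine Fin.cases ?_ (fun j => ?_) j
      · simpa [hwe] using heM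
      · exact hwM j
      · exact J.toSubalgebra.zero_mem
      · exact hPM i j
    · refine Fin.cases ?_ (fun i => ?_) i
      · exact hwV
      · exact hPV i
    · rw [Fin.sum_univ_succ]
      ext j
      refine Fin.cases ?_ (fun j => ?_) j
      · simp [hcons, hwe, hv0 v hv]
      · have h1 := congrFun (hdecomp v hv) j
        rw [hπ] at h1
        simp only [Fin.tail, Pi.add_apply, Finset.sum_apply, Pi.smul_apply, smul_eq_mul] at h1
        simp only [Fin.cons_zero, Fin.cons_succ, Pi.add_apply, Finset.sum_apply, Pi.smul_apply,
          smul_eq_mul, hcons]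
        linear_combination -h1

end Bimodule

/-! ### The two composites of the correspondence -/

section Intermediate

variable {K L : Type*} [CommRing K] [CommRing L] [Algebra K L]

theorem tensorProj_tmul (M : Subalgebra K L) (a b : L) :
    tensorProj M (a ⊗ₜ[K] b) = a ⊗ₜ[M] b := rfl

theorem mem_kerSubBimodule {M : Subalgebra K L} {x : L ⊗[K] L} :
    x ∈ (kerSubBimodule M).toAddSubgroup ↔ tensorProj M x = 0 := Iff.rfl

/-- The kernel of `L ⊗_K L → L ⊗_M L` is generated by the elements `am ⊗ b - a ⊗ mb`. -/
theorem kerSubBimodule_le {M : Subalgebra K L} {N : AddSubgroup (L ⊗[K] L)}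
    (h : ∀ m ∈ M, ∀ a b : L, (m * a) ⊗ₜ[K] b - a ⊗ₜ[K] (m * b) ∈ N) :
    (kerSubBimodule M).toAddSubgroup ≤ N := by
  let F : L ⊗[M] L →+ (L ⊗[K] L) ⧸ N := TensorProduct.liftAddHom
    (AddMonoidHom.mk' (fun a : L =>
      AddMonoidHom.mk' (fun b : L => QuotientAddGroup.mk' N (a ⊗ₜ[K] b))
        (fun b c => by rw [TensorProduct.tmul_add, map_add]))
      (fun a c => by
        ext b
        change QuotientAddGroup.mk' N ((a + c) ⊗ₜ[K] b) = _
        rw [TensorProduct.add_tmul, map_add]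
        rfl))
    (fun m a b => QuotientAddGroup.eq_iff_sub_mem.mpr (h m m.2 a b))
  have hF : ∀ x, F (tensorProj M x) = QuotientAddGroup.mk' N x := fun x => by
    induction x with
    | zero => simp
    | add x y hx hy => rw [map_add, map_add, map_add, hx, hy]
    | tmul a b => rfl
  intro x hx
  have h1 := hF x
  rw [mem_kerSubBimodule.mp hx, map_zero] at h1
  exact (QuotientAddGroup.eq_zero_iff x).mp h1.symm

theorem kerSubBimodule_toSubalgebra_le (J : SubBimodule K L) :
    (kerSubBimodule J.toSubalgebra).toAddSubgroup ≤ J.toAddSubgroup :=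
  kerSubBimodule_le fun _ hm a b =>
    (Ideal.Quotient.mk_eq_mk_iff_sub_mem _ _).mp (SubBimodule.mk_mul_tmul hm a b)

theorem kerSubBimodule_isCoideal (M : Subalgebra K L) : (kerSubBimodule M).IsCoideal := by
  refine ⟨fun x hx => ?_, fun x hx => ?_⟩
  · have h : ∀ x, coringCounit K L x = coringCounit M L (tensorProj M x) := fun x => by
      induction x with
      | zero => simp
      | add x y hx hy => rw [map_add, map_add, map_add, hx, hy]
      | tmul a b => rfl
    rw [h, mem_kerSubBimodule.mp hx, map_zero]
  · set Q := AddSubgroup.closure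
      {t : CoringTensor K L | ∃ j ∈ (kerSubBimodule M).toAddSubgroup, ∃ c : L ⊗[K] L,
        t = toRight j ⊗ₜ[L] c ∨ t = toRight c ⊗ₜ[L] j}
    refine kerSubBimodule_le (N := Q.comap (coringComul K L)) (fun m hm a b => ?_) hx
    have hj : ∀ a b : L, (m * a) ⊗ₜ[K] b - a ⊗ₜ[K] (m * b) ∈
        (kerSubBimodule M).toAddSubgroup := fun a b => by
      rw [mem_kerSubBimodule, map_sub, tensorProj_tmul, tensorProj_tmul, sub_eq_zero]
      exact TensorProduct.smul_tmul (⟨m, hm⟩ : M) a b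
    have h1 : toRight (a ⊗ₜ[K] m) = m • toRight (a ⊗ₜ[K] (1 : L)) := by
      rw [smul_toRight, rightAct_eq_mul, Algebra.TensorProduct.tmul_mul_tmul, one_mul, mul_one]
    -- Telescoping through the middle term `(a ⊗ m) ⊗ (1 ⊗ b) = (a ⊗ 1) ⊗ (m ⊗ b)`.
    have h2 : coringComul K L ((m * a) ⊗ₜ[K] b - a ⊗ₜ[K] (m * b)) =
        toRight ((m * a) ⊗ₜ[K] 1 - a ⊗ₜ[K] (m * 1)) ⊗ₜ[L] ((1 : L) ⊗ₜ[K] b) +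
        toRight (a ⊗ₜ[K] 1) ⊗ₜ[L] ((m * 1) ⊗ₜ[K] b - (1 : L) ⊗ₜ[K] (m * b)) := by
      rw [map_sub, coringComul_tmul, coringComul_tmul, TensorProduct.tmul_sub]
      have h3 : toRight ((m * a) ⊗ₜ[K] (1 : L) - a ⊗ₜ[K] (m * 1)) =
          toRight ((m * a) ⊗ₜ[K] (1 : L)) - toRight (a ⊗ₜ[K] m) := by
        rw [mul_one]
        rfl
      have h4 : (m * 1) ⊗ₜ[K] b = m • ((1 : L) ⊗ₜ[K] b) := rfl
      rw [h3, TensorProduct.sub_tmul, h1, h4, TensorProduct.smul_tmul]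
      abel
    change coringComul K L _ ∈ Q
    rw [h2]
    exact Q.add_mem (AddSubgroup.subset_closure ⟨_, hj a 1, _, Or.inl rfl⟩)
      (AddSubgroup.subset_closure ⟨_, hj 1 b, _, Or.inr rfl⟩)

/-- A coideal is contained in the kernel of `L ⊗_K L → L ⊗_{M_J} L`. -/
theorem SubBimodule.IsCoideal.le_kerSubBimodule [IsSemisimpleRing L] {J : SubBimodule K L}
    (hJ : J.IsCoideal)
    (hsymm : ∀ e : L, e * e = e → e ⊗ₜ[K] (1 - e) ∈ J.toIdeal → (1 - e) ⊗ₜ[K] e ∈ J.toIdeal) :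
    J.toAddSubgroup ≤ (kerSubBimodule J.toSubalgebra).toAddSubgroup := by
  intro x hx
  obtain ⟨n, a, b, rfl⟩ : ∃ (n : ℕ) (a b : Fin n → L), x = ∑ i, a i ⊗ₜ[K] b i := by
    obtain ⟨s, rfl⟩ := TensorProduct.exists_finset x
    refine ⟨s.card, fun i => (s.equivFin.symm i).1.1, fun i => (s.equivFin.symm i).1.2, ?_⟩
    rw [← Finset.sum_coe_sort, ← s.equivFin.symm.sum_comp]
  let V : Submodule L (Fin n → L) :=
    { carrier := {v | ∑ i, v i ⊗ₜ[K] b i ∈ J.toIdeal}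
      add_mem' := fun {v w} hv hw => by
        have := J.toIdeal.add_mem hv hw
        rw [← Finset.sum_add_distrib] at this
        simp only [← TensorProduct.add_tmul] at this
        exact this
      zero_mem' := by simp
      smul_mem' := fun c v hv => by
        have := J.toIdeal.mul_mem_left (c ⊗ₜ[K] 1) hv
        simpa [Finset.mul_sum] using this }
  obtain ⟨P, hPM, hPV, hP⟩ := J.exists_matrix hsymm n V
    fun v hv μ hμ => hJ.sum_tmul_mem hv hμ
  rw [mem_kerSubBimodule, map_sum]
  have h1 : ∀ j, a j = ∑ i, P i j * a i := fun j => by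
    have := congrFun (hP a hx) j
    simpa [mul_comm] using this.symm
  have h2 : ∀ i, ∑ j, P i j * b j = 0 := fun i => by
    -- The rows of `P` are relations, so the counit turns `∑ P i j ⊗ b j ∈ J` into an equation in
    -- `L`.
    have := hJ.1 _ (hPV i)
    simpa [coringCounit] using this
  calc ∑ j, tensorProj J.toSubalgebra (a j ⊗ₜ[K] b j)
      = ∑ j, ∑ i, a i ⊗ₜ[J.toSubalgebra] (P i j * b j) := by
        refine Finset.sum_congr rfl fun j _ => ?_
        rw [tensorProj_tmul, h1 j, TensorProduct.sum_tmul]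
        exact Finset.sum_congr rfl fun i _ =>
          TensorProduct.smul_tmul (⟨P i j, hPM i j⟩ : J.toSubalgebra) (a i) (b j)
    _ = 0 := by
        rw [Finset.sum_comm]
        refine Finset.sum_eq_zero fun i _ => ?_
        rw [← TensorProduct.tmul_sum, h2, TensorProduct.tmul_zero]

/-- An artinian reduced intermediate algebra is recovered from the kernel. -/
theorem toSubalgebra_kerSubBimodule [IsReduced L] (M : Subalgebra K L) [IsArtinianRing M] :
    (kerSubBimodule M).toSubalgebra = M := by
  have : IsReduced M := isReduced_of_injective M.val Subtype.val_injective
  have : IsSemisimpleRing M := IsArtinianRing.isSemisimpleRing_of_isReduced M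
  obtain ⟨p, hp⟩ := IsSemisimpleModule.extension_property (Algebra.linearMap M L)
    Subtype.val_injective LinearMap.id
  ext a
  rw [SubBimodule.mem_toSubalgebra, SubBimodule.mem_toIdeal, mem_kerSubBimodule, map_sub,
    tensorProj_tmul, tensorProj_tmul, sub_eq_zero]
  refine ⟨fun h => ?_, fun h => ?_⟩
  · let F : L ⊗[M] L →ₗ[M] L := TensorProduct.lift
      ((LinearMap.lsmul M L : M →ₗ[M] L →ₗ[M] L) ∘ₗ p)
    have h1 : p a • (1 : L) = p 1 • a := congrArg F h
    have h2 : p 1 = 1 := by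
      have := LinearMap.congr_fun hp 1
      simpa using this
    rw [h2, one_smul] at h1
    rw [← h1, Algebra.smul_def, mul_one]
    exact (p a).2
  · have := TensorProduct.smul_tmul (R := M) (⟨a, h⟩ : M) (1 : L) (1 : L)
    simpa [Algebra.smul_def] using this

end Intermediate

/-! ### Regularity of `M_J` and contraction of ideals -/

section Regular

variable {K L : Type*} [CommRing K] [CommRing L] [Algebra K L]

/-- The algebra `M_J` is von Neumann regular. -/
theorem SubBimodule.exists_quasiInverse [IsSemisimpleRing L] (J : SubBimodule K L) {a : L}
    (ha : a ∈ J.toSubalgebra) : ∃ b ∈ J.toSubalgebra, b * a * a = a := by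
  obtain ⟨e, he, hae⟩ := IsSemisimpleRing.ideal_eq_span_idempotent (Ideal.span {a})
  obtain ⟨c, hc⟩ := Ideal.mem_span_singleton'.mp (hae ▸ Ideal.mem_span_singleton_self a)
  obtain ⟨d, hd⟩ := Ideal.mem_span_singleton'.mp (hae.symm ▸ Ideal.mem_span_singleton_self e)
  have hea : e * a = a := by rw [← hc, mul_left_comm, he.eq]
  have hae' : a * (1 - e) = 0 := by linear_combination -hea
  -- Moving `a` across the tensor sign, with `a(1 - e) = 0` and `da = e`, puts both `(1 - e) ⊗ e`
  -- and `e ⊗ (1 - e)` in `J`.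
  have heM : e ∈ J.toSubalgebra := by
    have h1 := mk_mul_tmul ha (1 - e) d
    have h2 := mk_mul_tmul ha d (1 - e)
    rw [hae', mul_comm a d, hd, TensorProduct.zero_tmul, TensorProduct.sub_tmul, map_zero,
      map_sub, eq_comm, sub_eq_zero] at h1
    rw [hae', mul_comm a d, hd, TensorProduct.tmul_zero, TensorProduct.tmul_sub, map_zero,
      map_sub, sub_eq_zero] at h2
    rw [mem_toSubalgebra_iff, h1, h2]
  refine ⟨d * e, ?_, by linear_combination (e * a) * hd + (e + 1) * hea⟩
  have hde : a * (d * e) = e := by linear_combination e * hd + he.eq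
  rw [mem_toSubalgebra_iff]
  have h1 := mk_mul_tmul heM (d * e) 1
  have h2 := mk_mul_tmul ha (d * e) (d * e)
  have h3 := mk_mul_tmul heM 1 (d * e)
  have h4 : e * (d * e) = d * e := by linear_combination d * he.eq
  rw [h4] at h1 h3
  rw [mul_one] at h1 h3
  rw [hde] at h2
  -- `de ⊗ 1 ≡ de ⊗ e = de ⊗ a(de) ≡ e ⊗ de ≡ 1 ⊗ de`.
  rw [h1, ← h2, h3]

/-- Regularity gives every element of the extended ideal a local unit in `I`; those of two elements
combine as `e + e' - e e'`. -/
theorem comap_map_eq_of_regular {A B : Type*} [CommRing A] [CommRing B] {f : A →+* B}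
    (hf : Function.Injective f) (hA : ∀ a : A, ∃ b, b * a * a = a) (I : Ideal A) :
    (I.map f).comap f = I := by
  refine le_antisymm (fun x hx => ?_) Ideal.le_comap_map
  have key : ∀ z ∈ I.map f, ∃ e ∈ I, f e * z = z := fun z hz => by
    induction hz using Submodule.span_induction with
    | mem z hz =>
      obtain ⟨a, ha, rfl⟩ := hz
      obtain ⟨b, hb⟩ := hA a
      exact ⟨b * a, I.mul_mem_left b ha, by rw [← map_mul, hb]⟩
    | zero => exact ⟨0, I.zero_mem, mul_zero _⟩
    | add z z' _ _ hz hz' =>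
      obtain ⟨e, he, hez⟩ := hz
      obtain ⟨e', he', hez'⟩ := hz'
      refine ⟨e + e' - e * e', I.sub_mem (I.add_mem he he') (I.mul_mem_right _ he), ?_⟩
      rw [map_sub, map_add, map_mul]
      linear_combination (1 - f e') * hez + (1 - f e) * hez'
    | smul c z _ hz =>
      obtain ⟨e, he, hez⟩ := hz
      exact ⟨e, he, by rw [smul_eq_mul, mul_left_comm, hez]⟩
  obtain ⟨e, he, hex⟩ := key _ hx
  rw [← map_mul] at hex
  rw [← hf hex]
  exact I.mul_mem_right x he

theorem isArtinianRing_of_comap_map {A B : Type*} [CommRing A] [CommRing B] {f : A →+* B}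
    [IsArtinianRing B] (h : ∀ I : Ideal A, (I.map f).comap f = I) : IsArtinianRing A := by
  have hmono : StrictMono (Ideal.map f) :=
    (Monotone.strictMono_of_injective (fun _ _ => Ideal.map_mono)
      (Function.LeftInverse.injective h))
  exact ⟨(hmono.wellFoundedLT).wf⟩

end Regular

/-! ### Stability under `D` and symmetry of the idempotent relation -/

section Stable

open Coalgebra

variable {R D K L : Type*} [Field R] [Ring D] [HopfAlgebra R D]
  [CommRing K] [CommRing L] [Algebra R K] [Algebra R L] [Algebra K L] [IsScalarTower R K L]
  [Module D K] [Module D L] [IsScalarTower R D L]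
  [IsModuleAlgebra R D L] [IsInclusion D K L]

theorem tensorAct_groupLike {g : D} (hg : IsGroupLikeElem R g) (a b : L) :
    tensorAct R g (a ⊗ₜ[K] b) = (g • a) ⊗ₜ[K] (g • b) := by
  change tensorActTmul R K g a b = _
  rw [tensorActTmul, hg.comul_eq_tmul_self]
  rfl

theorem tensorAct_tmul_one (d : D) (a : L) :
    tensorAct R d (a ⊗ₜ[K] (1 : L)) = (d • a) ⊗ₜ[K] (1 : L) := by
  rw [tensorAct_tmul R d a 1 (ℛ R d)]
  have h : ∑ i ∈ (ℛ R d).index, counit (R := R) ((ℛ R d).right i) • (ℛ R d).left i = d := by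
    have := congrArg (TensorProduct.rid R D) (Coalgebra.sum_tmul_counit_eq (ℛ R d))
    simpa only [map_sum, TensorProduct.rid_tmul, one_smul] using this
  conv_rhs => rw [← h]
  rw [Finset.sum_smul, TensorProduct.sum_tmul]
  refine Finset.sum_congr rfl fun i _ => ?_
  rw [IsModuleAlgebra.smul_one (R := R), IsScalarTower.algebraMap_apply R K L,
    Algebra.algebraMap_eq_smul_one, ← TensorProduct.smul_tmul, smul_assoc, algebraMap_smul]

theorem tensorAct_one_tmul (d : D) (a : L) :
    tensorAct R d ((1 : L) ⊗ₜ[K] a) = (1 : L) ⊗ₜ[K] (d • a) := by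
  rw [tensorAct_tmul R d 1 a (ℛ R d)]
  have h : ∑ i ∈ (ℛ R d).index, counit (R := R) ((ℛ R d).left i) • (ℛ R d).right i = d := by
    have := congrArg (TensorProduct.lid R D) (Coalgebra.sum_counit_tmul_eq (ℛ R d))
    simpa only [map_sum, TensorProduct.lid_tmul, one_smul] using this
  conv_rhs => rw [← h]
  rw [Finset.sum_smul, TensorProduct.tmul_sum]
  refine Finset.sum_congr rfl fun i _ => ?_
  rw [IsModuleAlgebra.smul_one (R := R), IsScalarTower.algebraMap_apply R K L,
    Algebra.algebraMap_eq_smul_one, TensorProduct.smul_tmul, smul_assoc, algebraMap_smul]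

/-- For a stable ideal `J` the relation `e ⊗ (1 - e) ∈ J` between idempotents is symmetric. -/
theorem one_sub_tmul_mem [IsCocomm R D] (hpointed : IsPointed R D) (hBW : IsBirkhoffWitt R D)
    (hL : IsAS D L) {J : SubBimodule K L}
    (hJ : ∀ (d : D), ∀ x ∈ J.toAddSubgroup, tensorAct R d x ∈ J.toAddSubgroup)
    (f : L) (hf : f * f = f) (hfJ : f ⊗ₜ[K] (1 - f) ∈ J.toIdeal) :
    (1 - f) ⊗ₜ[K] f ∈ J.toIdeal := by
  have := hL.artinian
  have := hL.nontrivial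
  let X : Set L := {e | e * e = e ∧ e ⊗ₜ[K] (1 - e) ∈ J.toIdeal}
  have hmul : ∀ e ∈ X, ∀ h ∈ X, h * e ∈ X := by
    rintro e ⟨he, heJ⟩ h ⟨hh, hhJ⟩
    refine ⟨by linear_combination (h * h) * he + e * hh, ?_⟩
    have h1 := J.toIdeal.add_mem (J.toIdeal.mul_mem_left (h ⊗ₜ[K] 1) heJ)
      (J.toIdeal.mul_mem_left (e ⊗ₜ[K] e) hhJ)
    rw [Algebra.TensorProduct.tmul_mul_tmul, Algebra.TensorProduct.tmul_mul_tmul, mul_comm e h,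
      ← TensorProduct.tmul_add] at h1
    convert! h1 using 2
    ring
  have hact : ∀ g : D, IsGroupLikeElem R g → ∀ e ∈ X, g • e ∈ X := by
    rintro g hg e ⟨he, heJ⟩
    refine ⟨by rw [← IsGroupLikeElem.smul_mul hg, he], ?_⟩
    have h1 := hJ g _ heJ
    rwa [tensorAct_groupLike hg, smul_sub, IsGroupLikeElem.smul_one hg] at h1
  -- A minimal nonzero `e` in `X`: as `X` is closed under products, each member of `X` multiplies
  -- `e` to `0` or `e`.
  obtain ⟨_, ⟨e, heX, he0, rfl⟩, hmin⟩ := IsArtinian.set_has_minimal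
    {I : Ideal L | ∃ e ∈ X, e ≠ 0 ∧ Ideal.span {e} = I}
    ⟨_, 1, ⟨mul_one 1, by simp⟩, one_ne_zero, rfl⟩
  have hmin' : ∀ h ∈ X, h * e = 0 ∨ h * e = e := fun h hh => by
    by_cases h0 : h * e = 0
    · exact Or.inl h0
    right
    have hle : Ideal.span {h * e} ≤ Ideal.span {e} :=
      Ideal.span_singleton_le_span_singleton.mpr (Dvd.intro_left h rfl)
    have heq : Ideal.span {h * e} = Ideal.span {e} := by
      by_contra hne
      exact hmin _ ⟨_, hmul e heX h hh, h0, rfl⟩ (lt_of_le_of_ne hle hne)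
    obtain ⟨c, hc⟩ := Ideal.mem_span_singleton'.mp
      (heq.symm ▸ Ideal.mem_span_singleton_self e : e ∈ Ideal.span {h * e})
    linear_combination (1 - h) * hc + c * e * hh.1
  -- Applying minimality to `g⁻¹ f` shows that `f` annihilates or fixes `ge`. If it fixes it, `(1 -
  -- f) ge = 0`; otherwise `(1 ⊗ f)(ge ⊗ (1 - ge)) = ge ⊗ f` lies in `J`. The translates `ge`
  -- generate the unit ideal, so `z = 1` is allowed.
  have key : ∀ z ∈ Ideal.span {x | ∃ g : D, IsGroupLikeElem R g ∧ g • e = x},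
      ((1 - f) * z) ⊗ₜ[K] f ∈ J.toIdeal := fun z hz => by
    induction hz using Submodule.span_induction with
    | mem z hz =>
      obtain ⟨g, hg, rfl⟩ := hz
      have h1 : f * (g • e) = g • ((HopfAlgebra.antipode R g • f) * e) := by
        rw [IsGroupLikeElem.smul_mul hg, ← mul_smul, hg.mul_antipode_cancel, one_smul]
      rcases hmin' _ (hact _ hg.antipode f ⟨hf, hfJ⟩) with h | h
      · rw [h, smul_zero] at h1
        have h2 := J.toIdeal.mul_mem_left (1 ⊗ₜ[K] f) (hact g hg e heX).2
        rw [Algebra.TensorProduct.tmul_mul_tmul, one_mul, mul_sub, h1, mul_one, sub_zero] at h2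
        rwa [sub_mul, h1, one_mul, sub_zero]
      · rw [h] at h1
        rw [sub_mul, h1, one_mul, sub_self, TensorProduct.zero_tmul]
        exact J.toIdeal.zero_mem
    | zero => simp
    | add x y _ _ hx hy =>
      rw [mul_add, TensorProduct.add_tmul]
      exact J.toIdeal.add_mem hx hy
    | smul a x _ hx =>
      have h1 := J.toIdeal.mul_mem_left (a ⊗ₜ[K] 1) hx
      rwa [Algebra.TensorProduct.tmul_mul_tmul, one_mul, mul_left_comm] at h1
  have h1 := key 1 (by rw [span_groupLike_smul_eq_top hpointed hBW hL heX.1 he0]; trivial)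
  rwa [mul_one] at h1

/-- The kernel of `L ⊗_K L → L ⊗_M L` is a stable coideal. -/
theorem kerSubBimodule_mem_stableCoideals {M : Subalgebra K L} (hM : IsStableSubalgebra D M) :
    kerSubBimodule M ∈ stableCoideals R D K L := by
  refine ⟨kerSubBimodule_isCoideal M, fun d x hx => ?_⟩
  let _ : Module D M := subalgebraModule hM
  have : IsInclusion D M L := ⟨Subtype.val_injective, fun _ _ => rfl⟩
  have h : ∀ x, tensorProj M (tensorAct R d x) = tensorAct R d (tensorProj M x) := fun x => by
    induction x with
    | zero => simp
    | add x y hx hy => simp only [map_add, hx, hy]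
    | tmul a b =>
      rw [tensorProj_tmul, tensorAct_tmul R d a b (ℛ R d), tensorAct_tmul R d a b (ℛ R d), map_sum]
      rfl
  rw [mem_kerSubBimodule, h, mem_kerSubBimodule.mp hx, map_zero]

theorem toSubalgebra_stable {J : SubBimodule K L}
    (hJ : ∀ (d : D), ∀ x ∈ J.toAddSubgroup, tensorAct R d x ∈ J.toAddSubgroup) :
    IsStableSubalgebra D J.toSubalgebra := fun d a ha => by
  have h := hJ d _ (SubBimodule.mem_toSubalgebra.mp ha)
  rw [map_sub, tensorAct_tmul_one, tensorAct_one_tmul] at h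
  exact SubBimodule.mem_toSubalgebra.mpr h

/-- The algebra `M_J` of a stable `J` is AS. -/
theorem toSubalgebra_mem_intermediateAS [IsReduced L] (hL : IsAS D L) {J : SubBimodule K L}
    (hJ : ∀ (d : D), ∀ x ∈ J.toAddSubgroup, tensorAct R d x ∈ J.toAddSubgroup) :
    J.toSubalgebra ∈ intermediateAS D K L := by
  have := hL.artinian
  have := hL.nontrivial
  have : IsSemisimpleRing L := IsArtinianRing.isSemisimpleRing_of_isReduced L
  have hstab := toSubalgebra_stable hJ
  refine ⟨hstab, ?_⟩
  let _ : Module D J.toSubalgebra := subalgebraModule hstab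
  have hcomap := comap_map_eq_of_regular (f := algebraMap J.toSubalgebra L)
    Subtype.val_injective fun a => by
      obtain ⟨b, hb, hba⟩ := J.exists_quasiInverse a.2
      exact ⟨⟨b, hb⟩, Subtype.ext hba⟩
  refine ⟨isArtinianRing_of_comap_map hcomap, inferInstance, fun I hI => ?_⟩
  have h := hL.simple (I.map (algebraMap J.toSubalgebra L)) fun d x hx =>
    span_stable R (fun y hy d => by
      obtain ⟨a, ha, rfl⟩ := hy
      exact Ideal.subset_span ⟨d • a, hI d a ha, rfl⟩) hx d
  rcases h with h | h
  · left
    rw [← hcomap I, h]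
    exact (RingHom.injective_iff_ker_eq_bot _).mp Subtype.val_injective
  · right
    rw [← hcomap I, h, Ideal.comap_top]

end Stable

end DModAlg

theorem mainTheorem12 {R D K L : Type*} [Field R] [Ring D] [HopfAlgebra R D]
    [Coalgebra.IsCocomm R D]
    (hpointed : DModAlg.IsPointed R D) (hBW : DModAlg.IsBirkhoffWitt R D)
    [CommRing K] [CommRing L] [Algebra R K] [Algebra R L] [Algebra K L] [IsScalarTower R K L]
    [Module D K] [Module D L] [IsScalarTower R D K] [IsScalarTower R D L]
    [DModAlg.IsModuleAlgebra R D K] [DModAlg.IsModuleAlgebra R D L] [DModAlg.IsInclusion D K L]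
    (hK : DModAlg.IsAS D K) (hL : DModAlg.IsAS D L) :
    (∀ M ∈ DModAlg.intermediateAS D K L,
      DModAlg.kerSubBimodule M ∈ DModAlg.stableCoideals R D K L) ∧
    (∀ J ∈ DModAlg.stableCoideals R D K L,
      J.toSubalgebra ∈ DModAlg.intermediateAS D K L) ∧
    (∀ M ∈ DModAlg.intermediateAS D K L,
      (DModAlg.kerSubBimodule M).toSubalgebra = M) ∧
    (∀ J ∈ DModAlg.stableCoideals R D K L,
      DModAlg.kerSubBimodule J.toSubalgebra = J) := by
  have : IsReduced L := hL.isReduced hpointed hBW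
  have := hL.artinian
  have : IsSemisimpleRing L := IsArtinianRing.isSemisimpleRing_of_isReduced L
  refine ⟨fun M ⟨hM, _⟩ => DModAlg.kerSubBimodule_mem_stableCoideals hM,
    fun J hJ => DModAlg.toSubalgebra_mem_intermediateAS hL hJ.2, fun M ⟨hM, hAS⟩ => ?_,
    fun J hJ => ?_⟩
  · let _ := DModAlg.subalgebraModule hM
    have := hAS.artinian
    exact DModAlg.toSubalgebra_kerSubBimodule M
  · have h : (DModAlg.kerSubBimodule J.toSubalgebra).toAddSubgroup = J.toAddSubgroup :=
      le_antisymm (DModAlg.kerSubBimodule_toSubalgebra_le J)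
        (hJ.1.le_kerSubBimodule fun e he heJ =>
          DModAlg.one_sub_tmul_mem hpointed hBW hL hJ.2 e he heJ)
    have h1 := congrArg (fun H : AddSubgroup (L ⊗[K] L) => (H : Set (L ⊗[K] L))) h
    exact DModAlg.SubBimodule.ext h1
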